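/- Let $q$ be a prime power. For a matrix $X\in M(n,q)$, the algebra of $n\times n$ matrices over the field $\mathbb F_q$ with $q$ elements, and a monic irreducible $g\in\mathbb F_q[t]$ dividing the characteristic polynomial $c_X(t)$, let $\nu(g)$ be the multiplicity of $g$ in $c_X(t)$, and let $V(g)=\ker g(X)^{\nu(g)}$ be the $g$-primary component of the row space $V=\mathbb F_q^{1\times n}$, viewed as an $\mathbb F_q[X]$-module. Call $X$ \emph{uncyclic} if $V(g)$ is not a cyclic $\mathbb F_q[X]$-module for every monic irreducible divisor $g$ of $c_X(t)$, and let $\mathrm{unc}(n,q)$ be the number of uncyclic matrices in $M(n,q)$. For a real number $q>1$ put $$\omega(n,q)=\prod_{i=1}^{n}(1-q^{-i}),\qquad \omega(\infty,q)=\prod_{i\ge 1}(1-q^{-i}),\qquad c_0(\infty,q)=q^2\Bigl(1-\prod_{i\ge 2}(1-q^{-i})\Bigr),$$ $$c^*(q)=c_0(\infty,q)+q\,\frac{\omega(4,q)\,c_0(\infty,q^2)}{\omega(\infty,q^2)}\Bigl(q\log(1-q^{-2})-\log(1-q^{-1})\Bigr).$$ \textbf{Theorem.} For all $n\ge 1$,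 $$\mathrm{unc}(n,3)<1.56\cdot 3^{\,n^2-n-1}\,(1.59)^n .$$ For all $n\ge 1$ and all prime powers $q\ge 4$, $$\mathrm{unc}(n,q)<c^*(q)\,q^{\,n^2-n-1}\bigl(1+q^{-1}+2q^{-2}\bigr)^n .$$ Moreover $1<c^*(q)<1.56$ for all integers $q\ge 3$. -/

import Mathlib

open Polynomial

namespace Uncyclic

section Matrices

variable {F : Type*} [Field F] {n : ℕ}

/-- The `g`-primary component `V(g) = ker g(X)^ν(g)` of the space `V` of row vectors of length `n`
(on which `X` acts by right multiplication), where `ν(g)` is the multiplicity of `g` in the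
characteristic polynomial of `X`. -/
noncomputable def primaryComponent (X : Matrix (Fin n) (Fin n) F) (g : F[X]) :
    Submodule F (Fin n → F) :=
  LinearMap.ker (aeval X.vecMulLinear (g ^ multiplicity g X.charpoly))

/-- `X` is `f`-cyclic relative to `g`: the `g`-primary component is a cyclic `F[X]`-module, that
is, it contains a vector `v` such that every vector of it is `p(X)` applied to `v`, for some
polynomial `p`. -/
def IsCyclicRelativeTo (X : Matrix (Fin n) (Fin n) F) (g : F[X]) : Prop :=
  ∃ v ∈ primaryComponent X g, ∀ w ∈ primaryComponent X g,
    ∃ p : F[X], aeval X.vecMulLinear p v = w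

/-- `X` is uncyclic: for every monic irreducible divisor `g` of its characteristic polynomial, the
`g`-primary component is not cyclic. -/
def IsUncyclic (X : Matrix (Fin n) (Fin n) F) : Prop :=
  ∀ g : F[X], g.Monic → Irreducible g → g ∣ X.charpoly → ¬ IsCyclicRelativeTo X g

end Matrices

/-- `unc(n, q)`, where `q` is the number of elements of `F`: the number of uncyclic `n × n`
matrices over `F`. -/
noncomputable def unc (n : ℕ) (F : Type*) [Field F] : ℕ :=
  Nat.card {X : Matrix (Fin n) (Fin n) F // IsUncyclic X}

/-- `ω(n, q) = ∏_{i=1}^n (1 - q^{-i})`. -/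
noncomputable def omega (n : ℕ) (q : ℝ) : ℝ :=
  ∏ i ∈ Finset.Icc 1 n, (1 - (q ^ i)⁻¹)

/-- `ω(∞, q) = ∏_{i ≥ 1} (1 - q^{-i})`. -/
noncomputable def omegaInf (q : ℝ) : ℝ :=
  ∏' i : ℕ, (1 - (q ^ (i + 1))⁻¹)

/-- `c₀(∞, q) = q² (1 - ∏_{i ≥ 2} (1 - q^{-i}))`. -/
noncomputable def cZeroInf (q : ℝ) : ℝ :=
  q ^ 2 * (1 - ∏' i : ℕ, (1 - (q ^ (i + 2))⁻¹))

/-- The constant `c*(q)`. -/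
noncomputable def cStar (q : ℝ) : ℝ :=
  cZeroInf q + q * (omega 4 q * cZeroInf (q ^ 2) / omegaInf (q ^ 2)) *
    (q * Real.log (1 - (q ^ 2)⁻¹) - Real.log (1 - q⁻¹))

end Uncyclic

/-! Write `u n = q^n unc(n, q) / |GL(n, q)|`, which is `uncDensity`. Everything rests on a linear
recursive inequality for `u`.

The degree `n` of the characteristic polynomial is the sum of `deg g * ν(g)` over its monic
irreducible factors. Summing this over all uncyclic matrices turns `n * unc(n, q)` into a sum over
`g` and `m` of the number of uncyclic matrices with `ν(g) = m`. Such a matrix splits into a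
noncyclic block with characteristic polynomial `g^m` and an uncyclic block of size `n - m deg g`,
and `GL × GL` acts freely on the splittings (`card_endIsUncyclic_multiplicity_mul_le`).

Put `Q = q^(deg g)`. Relative to the general linear group, the endomorphisms with characteristic
polynomial `g^m` have proportion at most `1/(Q^m ω(m, Q))`, and the cyclic ones at least `1/(Q^m (1
- 1/Q))`. The difference bounds the noncyclic ones (`card_noncyclic_div_le`). It vanishes for `m =
1`, and after removal of `Q^(-m)` it is bounded independently of `m`. As there are at most `q^d / d`
monic irreducibles of degree `d`, one gets `n u(n) ≤ ℓ ∑ j u(n - j)` over `2 ≤ j ≤ n`, with an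
explicit `ℓ` (`mul_uncDensity_le_recursionBound`).

Induction with a Chebyshev-type inequality gives `u(n + 2) ≤ ℓ r^n` as soon as `ℓ ≤ 2(r - 1)`
(`le_mul_pow_of_recursion`). What remains is numerical: the two rates are admissible, and for `q ≥
4` the leading constant `1` already suffices, so `c*(q)` enters only through `c*(q) > 1`. The bounds
on `c*(q)` are proved separately from elementary estimates of products and logarithms. -/

namespace Uncyclic

/-! ### Polynomials in an endomorphism and characteristic polynomials -/

section Endomorphisms

variable {F : Type*} [Field F]
variable {V : Type*} [AddCommGroup V] [Module F V]
variable {W : Type*} [AddCommGroup W] [Module F W]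

theorem aeval_apply_of_intertwines (T : W →ₗ[F] V) {φ : Module.End F V} {ψ : Module.End F W}
    (h : ∀ x, φ (T x) = T (ψ x)) (p : F[X]) (x : W) : aeval φ p (T x) = T (aeval ψ p x) := by
  induction p using Polynomial.induction_on' generalizing x with
  | add p q hp hq => simp [hp, hq]
  | monomial k a =>
    have hk : ∀ y, (φ ^ k) (T y) = T ((ψ ^ k) y) := by
      induction k with
      | zero => intro y; simp
      | succ k ih => intro y; rw [pow_succ, pow_succ, Module.End.mul_apply, h, ih,
          Module.End.mul_apply]
    simp [aeval_monomial, hk, Module.algebraMap_end_apply]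

theorem aeval_conj_apply (e : W ≃ₗ[F] V) (ψ : Module.End F W) (p : F[X]) (x : W) :
    aeval (e.conj ψ) p (e x) = e (aeval ψ p x) :=
  aeval_apply_of_intertwines (e : W →ₗ[F] V) (φ := e.conj ψ) (ψ := ψ)
    (by intro y; simp [LinearEquiv.conj_apply]) p x

theorem aeval_prodMap_apply (A : Module.End F W) (Y : Module.End F V) (p : F[X]) (x : W × V) :
    aeval (A.prodMap Y : Module.End F (W × V)) p x = (aeval A p x.1, aeval Y p x.2) := by
  have h₁ := aeval_apply_of_intertwines (LinearMap.fst F W V) (φ := A)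
    (ψ := (A.prodMap Y : Module.End F (W × V))) (by intro y; simp) p x
  have h₂ := aeval_apply_of_intertwines (LinearMap.snd F W V) (φ := Y)
    (ψ := (A.prodMap Y : Module.End F (W × V))) (by intro y; simp) p x
  ext
  · simpa using h₁.symm
  · simpa using h₂.symm

/-- The characteristic polynomial of a block triangular endomorphism. -/
theorem charpoly_of_snd_comp_inl_eq_zero [FiniteDimensional F V] [FiniteDimensional F W]
    (ψ : Module.End F (W × V)) (h : ∀ x, (ψ (x, 0)).2 = 0) :
    ψ.charpoly = (LinearMap.fst F W V ∘ₗ ψ ∘ₗ LinearMap.inl F W V).charpoly *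
      (LinearMap.snd F W V ∘ₗ ψ ∘ₗ LinearMap.inr F W V).charpoly := by
  classical
  let b₁ := Module.finBasis F W
  let b₂ := Module.finBasis F V
  rw [← LinearMap.charpoly_toMatrix ψ (b₁.prod b₂), ← LinearMap.charpoly_toMatrix _ b₁,
    ← LinearMap.charpoly_toMatrix _ b₂]
  have : LinearMap.toMatrix (b₁.prod b₂) (b₁.prod b₂) ψ =
      Matrix.fromBlocks
        (LinearMap.toMatrix b₁ b₁ (LinearMap.fst F W V ∘ₗ ψ ∘ₗ LinearMap.inl F W V))
        (LinearMap.toMatrix b₂ b₁ (LinearMap.fst F W V ∘ₗ ψ ∘ₗ LinearMap.inr F W V)) 0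
        (LinearMap.toMatrix b₂ b₂ (LinearMap.snd F W V ∘ₗ ψ ∘ₗ LinearMap.inr F W V)) := by
    ext (i | i) (j | j) <;> simp [LinearMap.toMatrix_apply, h]
  rw [this, Matrix.charpoly_fromBlocks_zero₂₁]

/-- On monomials this is the geometric sum factorisation of `a^k - b^k`; linearity does the rest. -/
theorem _root_.Commute.exists_aeval_sub_aeval_eq_sub_mul {A : Type*} [Ring A] [Algebra F A]
    {a b : A} (h : Commute a b) (p : F[X]) : ∃ c, aeval a p - aeval b p = (a - b) * c := by
  induction p using Polynomial.induction_on' with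
  | add p q hp hq =>
    obtain ⟨c, hc⟩ := hp
    obtain ⟨d, hd⟩ := hq
    exact ⟨c + d, by rw [map_add, map_add, mul_add, ← hc, ← hd]; abel⟩
  | monomial k r =>
    refine ⟨r • ∑ i ∈ Finset.range k, a ^ i * b ^ (k - 1 - i), ?_⟩
    rw [mul_smul_comm, h.mul_geom_sum₂, aeval_monomial, aeval_monomial, ← mul_sub,
      Algebra.smul_def]

/-- If `p` annihilates `φ` then the characteristic polynomial of `φ` divides a power of `p`. -/
theorem charpoly_dvd_pow_of_aeval_eq_zero [FiniteDimensional F V] (φ : Module.End F V) {p : F[X]}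
    (hp : aeval φ p = 0) : φ.charpoly ∣ p ^ Module.finrank F V := by
  classical
  let b := Module.finBasis F V
  set M := LinearMap.toMatrix b b φ with hM
  have hpM : aeval M p = 0 := by
    have := Polynomial.aeval_algHom_apply (LinearMap.toMatrixAlgEquiv b).toAlgHom φ p
    rw [hp] at this
    have h2 : (LinearMap.toMatrixAlgEquiv b).toAlgHom φ = M := rfl
    rw [h2] at this
    simpa using this
  set a : Matrix (Fin (Module.finrank F V)) (Fin (Module.finrank F V)) F[X] :=
    Matrix.scalar _ (X : F[X]) with ha
  set c : Matrix (Fin (Module.finrank F V)) (Fin (Module.finrank F V)) F[X] :=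
    (Algebra.ofId F F[X]).mapMatrix M with hc
  -- The scalar matrix `X` commutes with `M`, so `X - M` divides `p(X) - p(M) = p(X)`, which is
  -- scalar. Taking determinants gives the divisibility.
  have hcomm : Commute a c := Matrix.scalar_commute _ (fun r => Commute.all _ _) _
  obtain ⟨B, hB⟩ := hcomm.exists_aeval_sub_aeval_eq_sub_mul p
  have h₁ : aeval a p = Matrix.scalar _ p := by
    have := Polynomial.aeval_algHom_apply (Matrix.scalarAlgHom (Fin (Module.finrank F V)) F
      (α := F[X])) X p
    simpa [ha] using this
  have h₂ : aeval c p = 0 := by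
    rw [hc, Polynomial.aeval_algHom_apply, hpM, map_zero]
  rw [h₁, h₂, sub_zero] at hB
  have := congrArg Matrix.det hB
  rw [Matrix.det_mul] at this
  rw [← LinearMap.charpoly_toMatrix φ b]
  refine ⟨B.det, ?_⟩
  rw [Matrix.charpoly, Matrix.charmatrix]
  rw [Matrix.scalar_apply, Matrix.det_diagonal, Finset.prod_const, Finset.card_univ,
    Fintype.card_fin] at this
  exact this

end Endomorphisms
-- Cyclic vectors and splitting off one primary component
section Endomorphisms

variable {F : Type*} [Field F]
variable {V : Type*} [AddCommGroup V] [Module F V]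
variable {W : Type*} [AddCommGroup W] [Module F W]

def HasCyclicVector (φ : Module.End F V) : Prop :=
  ∃ v, ∀ w, ∃ p : F[X], aeval φ p v = w

theorem HasCyclicVector.of_conj (e : W ≃ₗ[F] V) {φ : Module.End F W}
    (h : HasCyclicVector (e.conj φ)) : HasCyclicVector φ := by
  obtain ⟨v, hv⟩ := h
  refine ⟨e.symm v, fun w => ?_⟩
  obtain ⟨p, hp⟩ := hv (e w)
  refine ⟨p, e.injective ?_⟩
  rw [← aeval_conj_apply, e.apply_symm_apply, hp]

theorem HasCyclicVector.conj (e : W ≃ₗ[F] V) {φ : Module.End F W}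
    (h : HasCyclicVector φ) : HasCyclicVector (e.conj φ) := by
  refine HasCyclicVector.of_conj e.symm ?_
  convert h
  ext x
  simp [LinearEquiv.conj_apply]

theorem eq_zero_of_isCoprime_of_aeval {φ : Module.End F V} {p q : F[X]} (h : IsCoprime p q)
    {v : V} (hp : aeval φ p v = 0) (hq : aeval φ q v = 0) : v = 0 :=
  Submodule.disjoint_def.mp (Polynomial.disjoint_ker_aeval_of_isCoprime φ h) v hp hq

variable [FiniteDimensional F V] [FiniteDimensional F W]

/-- The `g`-primary component of `φ` is a cyclic `F[X]`-module. -/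
def EndIsCyclicAt (φ : Module.End F V) (g : F[X]) : Prop :=
  ∃ v, aeval φ (g ^ multiplicity g φ.charpoly) v = 0 ∧
    ∀ w, aeval φ (g ^ multiplicity g φ.charpoly) w = 0 → ∃ p : F[X], aeval φ p v = w

/-- The coordinate-free version of `IsUncyclic`. -/
def EndIsUncyclic (φ : Module.End F V) : Prop :=
  ∀ g : F[X], g.Monic → Irreducible g → g ∣ φ.charpoly → ¬ EndIsCyclicAt φ g

theorem charpoly_vecMulLinear {n : ℕ} (X : Matrix (Fin n) (Fin n) F) :
    X.vecMulLinear.charpoly = X.charpoly := by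
  rw [← Matrix.mulVecLin_transpose, Matrix.charpoly_mulVecLin, Matrix.charpoly_transpose]

theorem isUncyclic_iff {n : ℕ} (X : Matrix (Fin n) (Fin n) F) :
    IsUncyclic X ↔ EndIsUncyclic X.vecMulLinear := by
  simp only [IsUncyclic, EndIsUncyclic, IsCyclicRelativeTo, EndIsCyclicAt, primaryComponent,
    LinearMap.mem_ker, charpoly_vecMulLinear]

theorem EndIsUncyclic.conj (e : W ≃ₗ[F] V) {φ : Module.End F W} (h : EndIsUncyclic φ) :
    EndIsUncyclic (e.conj φ) := by
  intro g hg hirr hdvd hcyc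
  rw [LinearEquiv.charpoly_conj] at hdvd
  refine h g hg hirr hdvd ?_
  obtain ⟨v, hv, hw⟩ := hcyc
  rw [LinearEquiv.charpoly_conj] at hv hw
  refine ⟨e.symm v, ?_, fun w hw0 => ?_⟩
  · apply e.injective
    rw [← aeval_conj_apply, e.apply_symm_apply, hv, map_zero]
  · obtain ⟨p, hp⟩ := hw (e w) (by rw [aeval_conj_apply, hw0, map_zero])
    refine ⟨p, e.injective ?_⟩
    rw [← aeval_conj_apply, e.apply_symm_apply, hp]

theorem multiplicity_pow_mul_of_not_dvd {g k : F[X]} (hg : Irreducible g) (hk : ¬ g ∣ k)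
    (m : ℕ) : multiplicity g (g ^ m * k) = m := by
  refine multiplicity_eq_of_dvd_of_not_dvd (dvd_mul_right _ _) ?_
  rw [pow_succ]
  rw [mul_dvd_mul_iff_left (pow_ne_zero _ hg.ne_zero)]
  exact hk

theorem multiplicity_pow_mul_of_isCoprime {g g' k : F[X]} (hg' : Irreducible g')
    (h : IsCoprime g' g) (hk : k ≠ 0) (m : ℕ) :
    multiplicity g' (g ^ m * k) = multiplicity g' k := by
  have hfin : FiniteMultiplicity g' k := FiniteMultiplicity.of_prime_left hg'.prime hk
  refine multiplicity_eq_of_dvd_of_not_dvd ((pow_multiplicity_dvd _ _).mul_left _) ?_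
  intro hd
  exact hfin.not_pow_dvd_of_multiplicity_lt (Nat.lt_succ_self _)
    ((h.pow (m := multiplicity g' k + 1) (n := m)).dvd_of_dvd_mul_left hd)

/-- If `φ = A ⊕ Y` is uncyclic, where `A` has characteristic polynomial `g ^ m` and that of `Y` is
prime to `g`, then `Y` is uncyclic. -/
theorem EndIsUncyclic.of_prodMap_right {A : Module.End F W} {Y : Module.End F V} {g : F[X]}
    {m : ℕ} (hA : A.charpoly = g ^ m) (hY : IsCoprime g Y.charpoly)
    (h : EndIsUncyclic (A.prodMap Y : Module.End F (W × V))) : EndIsUncyclic Y := by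
  intro g' hmon hirr hdvd hcyc
  have hcop : IsCoprime g' g := (hY.of_isCoprime_of_dvd_right hdvd).symm
  refine h g' hmon hirr (by rw [LinearMap.charpoly_prodMap]; exact hdvd.mul_left _) ?_
  obtain ⟨v, hv, hw⟩ := hcyc
  refine ⟨(0, v), ?_⟩
  rw [LinearMap.charpoly_prodMap, hA,
    multiplicity_pow_mul_of_isCoprime hirr hcop Y.charpoly_monic.ne_zero]
  refine ⟨by rw [aeval_prodMap_apply]; simp [-map_pow, hv], ?_⟩
  rintro ⟨w, y⟩ hwy
  rw [aeval_prodMap_apply] at hwy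
  obtain ⟨h1, h2⟩ := Prod.mk.inj hwy
  have hw0 : w = 0 := eq_zero_of_isCoprime_of_aeval (hcop.pow (n := m)) h1
    (by rw [← hA]; simp [LinearMap.aeval_self_charpoly])
  obtain ⟨p, hp⟩ := hw y h2
  exact ⟨p, by rw [aeval_prodMap_apply]; simp [hp, hw0]⟩

/-- Since `g` is prime to the characteristic polynomial of `Y`, the `g`-primary component of `A ⊕ Y`
is exactly the first summand, so a cyclic vector `v` of `A` would make `(v, 0)` generate it. -/
theorem EndIsUncyclic.of_prodMap_left {A : Module.End F W} {Y : Module.End F V} {g : F[X]}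
    (hmon : g.Monic) (hirr : Irreducible g)
    {m : ℕ} (hm : m ≠ 0) (hA : A.charpoly = g ^ m) (hY : IsCoprime g Y.charpoly)
    (h : EndIsUncyclic (A.prodMap Y : Module.End F (W × V))) : ¬ HasCyclicVector A := by
  rintro ⟨v, hv⟩
  have hnd : ¬ g ∣ Y.charpoly := fun hd => hirr.not_isUnit (hY.isUnit_of_dvd' dvd_rfl hd)
  refine h g hmon hirr (by
    rw [LinearMap.charpoly_prodMap, hA]; exact (dvd_pow_self _ hm).mul_right _) ⟨(v, 0), ?_⟩
  rw [LinearMap.charpoly_prodMap, hA, multiplicity_pow_mul_of_not_dvd hirr hnd]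
  refine ⟨by rw [aeval_prodMap_apply, ← hA]; simp [LinearMap.aeval_self_charpoly], ?_⟩
  rintro ⟨w, y⟩ hwy
  rw [aeval_prodMap_apply] at hwy
  obtain ⟨h1, h2⟩ := Prod.mk.inj hwy
  have hy0 : y = 0 := eq_zero_of_isCoprime_of_aeval (hY.pow_left (m := m)) h2
    (by simp [LinearMap.aeval_self_charpoly])
  obtain ⟨p, hp⟩ := hv w
  exact ⟨p, by rw [aeval_prodMap_apply]; simp [hp, hy0]⟩

/-- The primary decomposition with respect to one irreducible factor. -/
theorem exists_conj_prodMap {φ : Module.End F V} {g : F[X]} (hmon : g.Monic)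
    (hirr : Irreducible g) {m k : ℕ} (hm : multiplicity g φ.charpoly = m)
    (hV : Module.finrank F V = g.natDegree * m + k) :
    ∃ (e : ((Fin (g.natDegree * m) → F) × (Fin k → F)) ≃ₗ[F] V)
      (A : Module.End F (Fin (g.natDegree * m) → F)) (Y : Module.End F (Fin k → F)),
      A.charpoly = g ^ m ∧ IsCoprime g Y.charpoly ∧
        φ = e.conj (A.prodMap Y : Module.End F (_ × _)) := by
  obtain ⟨c, hc⟩ : g ^ m ∣ φ.charpoly := hm ▸ pow_multiplicity_dvd _ _
  have hc0 : c.Monic := (hmon.pow m).of_mul_monic_left (hc ▸ φ.charpoly_monic)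
  have hgc : IsCoprime g c := by
    rw [hirr.coprime_iff_not_dvd]
    intro hd
    have hfin : FiniteMultiplicity g φ.charpoly :=
      FiniteMultiplicity.of_prime_left hirr.prime φ.charpoly_monic.ne_zero
    refine hfin.not_pow_dvd_of_multiplicity_lt (m := m + 1) (by omega) ?_
    rw [hc, pow_succ]
    exact mul_dvd_mul_left _ hd
  set K := LinearMap.ker (aeval φ (g ^ m)) with hK
  set L := LinearMap.ker (aeval φ c) with hL
  have hcompl : IsCompl K L := by
    refine ⟨Polynomial.disjoint_ker_aeval_of_isCoprime φ hgc.pow_left, ?_⟩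
    rw [codisjoint_iff, Polynomial.sup_ker_aeval_eq_ker_aeval_mul_of_coprime φ hgc.pow_left, ← hc,
      LinearMap.aeval_self_charpoly, LinearMap.ker_zero]
  have hinv : ∀ (p : F[X]), ∀ x ∈ LinearMap.ker (aeval φ p), φ x ∈ LinearMap.ker (aeval φ p) := by
    intro p x hx
    rw [LinearMap.mem_ker] at hx ⊢
    rw [aeval_apply_of_intertwines φ (fun _ => rfl) p x, hx, map_zero]
  set A₀ : Module.End F K := φ.restrict (hinv _) with hA₀
  set Y₀ : Module.End F L := φ.restrict (hinv _) with hY₀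
  have hA₀p : aeval A₀ (g ^ m) = 0 := by
    ext x
    have := aeval_apply_of_intertwines K.subtype (φ := φ) (ψ := A₀) (fun _ => rfl) (g ^ m) x
    rw [LinearMap.zero_apply, ZeroMemClass.coe_zero, ← K.subtype_apply, ← this]
    exact x.2
  have hY₀p : aeval Y₀ c = 0 := by
    ext x
    have := aeval_apply_of_intertwines L.subtype (φ := φ) (ψ := Y₀) (fun _ => rfl) c x
    rw [LinearMap.zero_apply, ZeroMemClass.coe_zero, ← L.subtype_apply, ← this]
    exact x.2
  let e₀ := Submodule.prodEquivOfIsCompl K L hcompl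
  have hφ : φ = e₀.conj (A₀.prodMap Y₀ : Module.End F (K × L)) := by
    ext x
    obtain ⟨⟨a, b⟩, rfl⟩ := e₀.surjective x
    simp [LinearEquiv.conj_apply, e₀, A₀, Y₀]
  have hchar : A₀.charpoly * Y₀.charpoly = g ^ m * c := by
    rw [← LinearMap.charpoly_prodMap, ← hc]
    conv_rhs => rw [hφ, LinearEquiv.charpoly_conj]
  have hYc : IsCoprime g Y₀.charpoly :=
    hgc.pow_right.of_isCoprime_of_dvd_right (charpoly_dvd_pow_of_aeval_eq_zero Y₀ hY₀p)
  -- The restriction to `K` is killed by `g^m`, so its characteristic polynomial is some power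
  -- `g^i`. Comparing the multiplicity of `g` on both sides of `hchar` then forces `i = m`, which
  -- fixes the dimensions of `K` and `L`.
  obtain ⟨i, -, hi⟩ : ∃ i ≤ m * Module.finrank F K, A₀.charpoly = g ^ i := by
    have := charpoly_dvd_pow_of_aeval_eq_zero A₀ hA₀p
    rw [← pow_mul, dvd_prime_pow hirr.prime] at this
    obtain ⟨i, hi, h⟩ := this
    exact ⟨i, hi, eq_of_monic_of_associated A₀.charpoly_monic (hmon.pow i) h⟩
  have him : i = m := by
    have h1 := multiplicity_pow_mul_of_not_dvd hirr (hirr.coprime_iff_not_dvd.mp hYc) i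
    have h2 := multiplicity_pow_mul_of_not_dvd hirr (hirr.coprime_iff_not_dvd.mp hgc) m
    rw [← hi, hchar, h2] at h1
    exact h1.symm
  subst him
  have hKdim : Module.finrank F K = g.natDegree * i := by
    rw [← A₀.charpoly_natDegree, hi, natDegree_pow, mul_comm]
  have hLdim : Module.finrank F L = k := by
    have := Submodule.finrank_add_eq_of_isCompl hcompl
    omega
  let eK : K ≃ₗ[F] (Fin (g.natDegree * i) → F) :=
    LinearEquiv.ofFinrankEq _ _ (by simp [hKdim])
  let eL : L ≃ₗ[F] (Fin k → F) := LinearEquiv.ofFinrankEq _ _ (by simp [hLdim])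
  refine ⟨(eK.prodCongr eL).symm.trans e₀, eK.conj A₀, eL.conj Y₀, ?_, ?_, ?_⟩
  · rw [LinearEquiv.charpoly_conj, hi]
  · rwa [LinearEquiv.charpoly_conj]
  · refine hφ.trans ?_
    ext x
    simp [LinearEquiv.conj_apply]

end Endomorphisms
-- Orders of general linear groups and counting by splittings
section Counting

/-- The order of the general linear group of degree `n` over a field with `q` elements. -/
def cardGL (q n : ℕ) : ℕ := ∏ i : Fin n, (q ^ n - q ^ (i : ℕ))

theorem cardGL_pos {q : ℕ} (hq : 1 < q) (n : ℕ) : 0 < cardGL q n :=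
  Finset.prod_pos fun i _ => Nat.sub_pos_of_lt (Nat.pow_lt_pow_right hq i.2)

/-- An invertible matrix is an independent `j`-tuple followed by `k` further vectors; the last `k`
factors of the order each carry a factor `q^j`. -/
theorem prod_mul_cardGL (q j k : ℕ) :
    (∏ i : Fin j, (q ^ (j + k) - q ^ (i : ℕ))) * (q ^ (j * k) * cardGL q k) =
      cardGL q (j + k) := by
  rw [cardGL, cardGL, Fin.prod_univ_add]
  congr 1
  have : ∀ i : Fin k, q ^ (j + k) - q ^ ((Fin.natAdd j i : Fin (j + k)) : ℕ) =
      q ^ j * (q ^ k - q ^ (i : ℕ)) := by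
    intro i
    rw [Nat.mul_sub, Fin.val_natAdd, pow_add, pow_add]
  simp_rw [this]
  rw [Finset.prod_mul_distrib, Finset.prod_const, Finset.card_univ, Fintype.card_fin, ← pow_mul]

variable {F : Type*} [Field F] [Finite F]
variable {V : Type*} [AddCommGroup V] [Module F V] [FiniteDimensional F V]
variable {W : Type*} [AddCommGroup W] [Module F W] [FiniteDimensional F W]

theorem finite_of_finiteDimensional (F V : Type*) [Field F] [Finite F] [AddCommGroup V]
    [Module F V] [FiniteDimensional F V] : Finite V :=
  Module.finite_of_finite F

instance finite_linearMap : Finite (V →ₗ[F] W) :=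
  Module.finite_of_finite F

instance finite_linearEquiv : Finite (V ≃ₗ[F] W) :=
  Finite.of_injective (fun e => (e : V →ₗ[F] W)) LinearEquiv.toLinearMap_injective

theorem card_linearIndependent_fin {j n : ℕ} (hV : Module.finrank F V = n) (hj : j ≤ n) :
    Nat.card {s : Fin j → V // LinearIndependent F s} =
      ∏ i : Fin j, (Nat.card F ^ n - Nat.card F ^ (i : ℕ)) := by
  have := Fintype.ofFinite F
  have := finite_of_finiteDimensional F V
  subst hV
  rw [card_linearIndependent hj, Nat.card_eq_fintype_card]

theorem card_linearEquiv {n : ℕ} (hV : Module.finrank F V = n) (hW : Module.finrank F W = n) :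
    Nat.card (W ≃ₗ[F] V) = cardGL (Nat.card F) n := by
  have := Fintype.ofFinite F
  let eW : W ≃ₗ[F] (Fin n → F) := LinearEquiv.ofFinrankEq _ _ (by simp [hW])
  let eV : V ≃ₗ[F] (Fin n → F) := LinearEquiv.ofFinrankEq _ _ (by simp [hV])
  have h₁ : Nat.card (W ≃ₗ[F] V) = Nat.card ((Fin n → F) ≃ₗ[F] (Fin n → F)) :=
    Nat.card_congr
      { toFun := fun e => (eW.symm.trans e).trans eV
        invFun := fun e => (eW.trans e).trans eV.symm
        left_inv := fun e => by ext; simp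
        right_inv := fun e => by ext; simp }
  have h₂ := Nat.card_congr (Matrix.GeneralLinearGroup.toLin (n := Fin n) (R := F)).toEquiv
  have h₃ := Nat.card_congr
    (LinearMap.GeneralLinearGroup.generalLinearEquiv F (Fin n → F)).toEquiv
  rw [h₁, ← h₃, ← h₂, Matrix.card_GL_field, cardGL, Nat.card_eq_fintype_card]

theorem unc_eq (n : ℕ) (F : Type*) [Field F] :
    unc n F = Nat.card {φ : Module.End F (Fin n → F) // EndIsUncyclic φ} := by
  refine Nat.card_congr (Equiv.subtypeEquiv
    (LinearMap.toMatrixRight' (R := F) (m := Fin n) (n := Fin n)).symm.toEquiv fun X => ?_)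
  exact isUncyclic_iff X

/-- The number of uncyclic endomorphisms for which the `g`-primary component has length `m`. -/
theorem card_endIsUncyclic_multiplicity_mul_le {g : F[X]} (hmon : g.Monic) (hirr : Irreducible g)
    {m k : ℕ} (hm : m ≠ 0) (hV : Module.finrank F V = g.natDegree * m + k) :
    Nat.card {φ : Module.End F V // EndIsUncyclic φ ∧ multiplicity g φ.charpoly = m} *
        (cardGL (Nat.card F) (g.natDegree * m) * cardGL (Nat.card F) k) ≤
      cardGL (Nat.card F) (g.natDegree * m + k) *
        (Nat.card {A : Module.End F (Fin (g.natDegree * m) → F) //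
          A.charpoly = g ^ m ∧ ¬ HasCyclicVector A} * unc k F) := by
  choose e A Y hA hY hφ using fun φ : {φ : Module.End F V //
    EndIsUncyclic φ ∧ multiplicity g φ.charpoly = m} => exists_conj_prodMap hmon hirr φ.2.2 hV
  have hunc : ∀ φ : {φ : Module.End F V // EndIsUncyclic φ ∧ multiplicity g φ.charpoly = m},
      EndIsUncyclic ((A φ).prodMap (Y φ) : Module.End F (_ × _)) := by
    intro φ
    have := φ.2.1.conj (e φ).symm
    rw [hφ φ] at this
    convert this
    ext x <;> simp [LinearEquiv.conj_apply]
  rw [← card_linearEquiv (F := F) (W := Fin (g.natDegree * m) → F)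
      (V := Fin (g.natDegree * m) → F) (by simp) (by simp),
    ← card_linearEquiv (F := F) (W := Fin k → F) (V := Fin k → F) (by simp) (by simp),
    ← card_linearEquiv (F := F) (W := (Fin (g.natDegree * m) → F) × (Fin k → F)) (V := V)
      hV (by simp), unc_eq, ← Nat.card_prod, ← Nat.card_prod, ← Nat.card_prod, ← Nat.card_prod]
  -- The chosen splitting of `φ` is twisted by `a ⊕ b`, and its blocks are conjugated back
  -- accordingly. The twisted isomorphism and blocks still reconstruct `φ` (`key`); once `φ` is
  -- known, so is the chosen `e φ`, and hence `a` and `b`.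
  refine Nat.card_le_card_of_injective (fun x => ((x.2.1.prodCongr x.2.2).trans (e x.1),
    (⟨x.2.1.symm.conj (A x.1), ?_, ?_⟩, ⟨x.2.2.symm.conj (Y x.1), ?_⟩))) ?_
  · rw [LinearEquiv.charpoly_conj, hA]
  · exact fun h => (hunc x.1).of_prodMap_left hmon hirr hm (hA _) (hY _) h.of_conj
  · exact ((hunc x.1).of_prodMap_right (hA _) (hY _)).conj _
  · rintro ⟨φ, a, b⟩ ⟨φ', a', b'⟩ h
    simp only [Prod.mk.injEq, Subtype.mk.injEq] at h
    obtain ⟨h₁, h₂, h₃⟩ := h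
    have key : ∀ (φ : {φ : Module.End F V // EndIsUncyclic φ ∧ multiplicity g φ.charpoly = m})
        (a : (Fin (g.natDegree * m) → F) ≃ₗ[F] (Fin (g.natDegree * m) → F))
        (b : (Fin k → F) ≃ₗ[F] (Fin k → F)), φ.1 = ((a.prodCongr b).trans (e φ)).conj
          ((a.symm.conj (A φ)).prodMap (b.symm.conj (Y φ)) : Module.End F (_ × _)) := by
      intro φ a b
      refine (hφ φ).trans ?_
      ext x
      simp [LinearEquiv.conj_apply]
    have hφφ' : φ = φ' := by
      apply Subtype.ext
      rw [key φ a b, key φ' a' b', h₁, h₂, h₃]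
    subst hφφ'
    have hab : a.prodCongr b = a'.prodCongr b' := by
      ext x : 1
      exact (e φ).injective (by simpa using LinearEquiv.congr_fun h₁ x)
    have ha : a = a' := by
      ext x : 1
      simpa using congrArg Prod.fst (LinearEquiv.congr_fun hab (x, 0))
    have hb : b = b' := by
      ext x : 1
      simpa using congrArg Prod.snd (LinearEquiv.congr_fun hab (0, x))
    rw [ha, hb]

end Counting
-- Annihilators of vectors when the characteristic polynomial is a prime power
section PrimePower

variable {F : Type*} [Field F]
variable {V : Type*} [AddCommGroup V] [Module F V]

/-- `h` is the monic generator of the annihilator of `v` under `φ`, that is, `h(φ) v = 0` and no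
nonzero polynomial of smaller degree kills `v`. -/
structure IsVectorMinpoly (φ : Module.End F V) (v : V) (h : F[X]) : Prop where
  aeval_eq_zero : aeval φ h v = 0
  eq_zero_of_degree_lt : ∀ p : F[X], p.degree < h.degree → aeval φ p v = 0 → p = 0

theorem sum_C_mul_X_pow_degree_lt {j : ℕ} (c : Fin j → F) :
    (∑ s : Fin j, C (c s) * X ^ (s : ℕ)).degree < (j : WithBot ℕ) := by
  refine (degree_sum_le _ _).trans_lt ?_
  rw [Finset.sup_lt_iff (WithBot.bot_lt_coe _)]
  intro s _
  exact (degree_C_mul_X_pow_le _ _).trans_lt (by exact_mod_cast s.2)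

theorem IsVectorMinpoly.linearIndependent {φ : Module.End F V} {v : V} {h : F[X]}
    (H : IsVectorMinpoly φ v h) {j : ℕ} (hj : h.degree = j) :
    LinearIndependent F (fun s : Fin j => (φ ^ (s : ℕ)) v) := by
  rw [Fintype.linearIndependent_iff]
  intro c hc i
  have hp := H.eq_zero_of_degree_lt (∑ s : Fin j, C (c s) * X ^ (s : ℕ))
    (hj ▸ sum_C_mul_X_pow_degree_lt c) (by
      simpa [map_sum, Module.algebraMap_end_apply, LinearMap.sum_apply] using hc)
  have := congrArg (fun p => p.coeff i) hp
  simpa [finsetSum_coeff, coeff_C_mul, coeff_X_pow, Fin.val_inj] using this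

theorem pow_natDegree_apply_eq {φ : Module.End F V} {v : V} {h : F[X]} {j : ℕ}
    (H : IsVectorMinpoly φ v h) (hmon : h.Monic)
    (hj : h.natDegree = j) :
    (φ ^ j) v = -∑ s : Fin j, h.coeff s • (φ ^ (s : ℕ)) v := by
  have := H.aeval_eq_zero
  rw [aeval_eq_sum_range, hj, Finset.sum_range_succ, ← hj, hmon.coeff_natDegree, hj, one_smul,
    LinearMap.add_apply, Finset.sum_range, LinearMap.sum_apply] at this
  rw [eq_neg_iff_add_eq_zero, add_comm]
  simpa using this

theorem linearMap_ext_of_single {j : ℕ} {M : Type*} [AddCommGroup M] [Module F M]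
    {f f' : (Fin j → F) →ₗ[F] M} (h : ∀ s, f (Pi.single s 1) = f' (Pi.single s 1)) : f = f' :=
  (Pi.basisFun F (Fin j)).ext fun s => by simpa using h s

/-- The span of `v, φ v, ..., φ^(j-1) v` is invariant, because `h` expresses `φ^j v` through the
earlier vectors. This provides the zero block. -/
theorem conj_symm_inl_snd {φ : Module.End F V} {v : V} {h : F[X]} {j k : ℕ}
    {e : ((Fin j → F) × (Fin k → F)) ≃ₗ[F] V} (H : IsVectorMinpoly φ v h) (hmon : h.Monic) (hj : h.natDegree = j)
    (he : ∀ s, e (Pi.single s 1, 0) = (φ ^ (s : ℕ)) v) (x : Fin j → F) :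
    (e.symm (φ (e (x, 0)))).2 = 0 := by
  have hrange : ∀ s : Fin j, (e.symm ((φ ^ (s : ℕ)) v)).2 = 0 := by
    intro s
    rw [← he, e.symm_apply_apply]
  suffices (LinearMap.snd F _ _ ∘ₗ e.symm.toLinearMap ∘ₗ φ ∘ₗ e.toLinearMap ∘ₗ
      LinearMap.inl F _ _ : (Fin j → F) →ₗ[F] (Fin k → F)) = 0 from LinearMap.congr_fun this x
  refine linearMap_ext_of_single fun s => ?_
  simp only [LinearMap.comp_apply, LinearMap.inl_apply, LinearEquiv.coe_coe, he,
    LinearMap.snd_apply, LinearMap.zero_apply]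
  rw [← Module.End.mul_apply, ← pow_succ']
  rcases Nat.lt_or_ge (s + 1) j with hs | hs
  · exact hrange ⟨s + 1, hs⟩
  · rw [show (s : ℕ) + 1 = j by omega, pow_natDegree_apply_eq H hmon hj]
    simp [Prod.snd_sum, hrange]

/-- By Cayley–Hamilton the characteristic polynomial of the block kills `v`. It and `h` are monic of
the same degree, so their difference kills `v` in smaller degree and must vanish. -/
theorem charpoly_fst_conj_inl {φ : Module.End F V} {v : V} {h : F[X]} {j k : ℕ}
    {e : ((Fin j → F) × (Fin k → F)) ≃ₗ[F] V} (H : IsVectorMinpoly φ v h) (hmon : h.Monic)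
    (hj : h.natDegree = j) (hj0 : j ≠ 0)
    (he : ∀ s, e (Pi.single s 1, 0) = (φ ^ (s : ℕ)) v) :
    (LinearMap.fst F _ _ ∘ₗ e.symm.conj φ ∘ₗ LinearMap.inl F _ _ :
      Module.End F (Fin j → F)).charpoly = h := by
  set B : Module.End F (Fin j → F) :=
    LinearMap.fst F _ _ ∘ₗ e.symm.conj φ ∘ₗ LinearMap.inl F _ _ with hB
  have hint : ∀ x, φ ((e.toLinearMap ∘ₗ LinearMap.inl F _ _) x) =
      (e.toLinearMap ∘ₗ LinearMap.inl F _ _) (B x) := by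
    intro x
    apply e.symm.injective
    ext1
    · simp [hB, LinearEquiv.conj_apply]
    · simpa using conj_symm_inl_snd H hmon hj he x
  have hv : (e.toLinearMap ∘ₗ LinearMap.inl F _ _)
      (Pi.single ⟨0, Nat.pos_of_ne_zero hj0⟩ 1) = v := by
    simpa using he ⟨0, Nat.pos_of_ne_zero hj0⟩
  have hkill : aeval φ B.charpoly v = 0 := by
    have := aeval_apply_of_intertwines (e.toLinearMap ∘ₗ LinearMap.inl F _ _) hint B.charpoly
      (Pi.single ⟨0, Nat.pos_of_ne_zero hj0⟩ 1)
    rwa [hv, LinearMap.aeval_self_charpoly, LinearMap.zero_apply, map_zero] at this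
  have hdeg : B.charpoly.degree = h.degree := by
    rw [degree_eq_natDegree B.charpoly_monic.ne_zero, degree_eq_natDegree hmon.ne_zero,
      LinearMap.charpoly_natDegree, hj]
    simp
  refine sub_eq_zero.mp (H.eq_zero_of_degree_lt _ ?_ ?_)
  · rw [← hdeg]
    exact degree_sub_lt_left hdeg B.charpoly_monic.ne_zero
      (by rw [B.charpoly_monic.leadingCoeff, hmon.leadingCoeff])
  · rw [map_sub, LinearMap.sub_apply, hkill, H.aeval_eq_zero, sub_zero]

variable [FiniteDimensional F V]

/-- Take the least `i` with `g^i` killing `v`. If `p` kills `v`, so does its gcd with `g^i` by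
Bézout; that gcd is associated to a power of `g`, hence to `g^i` itself, so `g^i` divides `p`. -/
theorem exists_isVectorMinpoly {φ : Module.End F V} {g : F[X]} (hirr : Irreducible g)
    {m : ℕ} (hφ : φ.charpoly = g ^ m) {v : V} (hv : v ≠ 0) :
    ∃ i, 1 ≤ i ∧ i ≤ m ∧ IsVectorMinpoly φ v (g ^ i) := by
  classical
  have hex : ∃ i, aeval φ (g ^ i) v = 0 :=
    ⟨m, by rw [← hφ, LinearMap.aeval_self_charpoly, LinearMap.zero_apply]⟩
  refine ⟨Nat.find hex, ?_, ?_, Nat.find_spec hex, ?_⟩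
  · rw [Nat.one_le_iff_ne_zero]
    intro h0
    have := Nat.find_spec hex
    rw [h0] at this
    exact hv (by simpa using this)
  · exact Nat.find_min' hex (by rw [← hφ, LinearMap.aeval_self_charpoly, LinearMap.zero_apply])
  · intro p hp hpv
    by_contra hp0
    obtain ⟨l, hl, hass⟩ := (dvd_prime_pow hirr.prime _).mp
      (EuclideanDomain.gcd_dvd_right p (g ^ Nat.find hex))
    have hgl : aeval φ (g ^ l) v = 0 := by
      obtain ⟨u, hu⟩ := hass
      rw [← hu, EuclideanDomain.gcd_eq_gcd_ab]
      rw [mul_comm _ (u : F[X]), map_mul, Module.End.mul_apply, map_add, mul_comm p, mul_comm (g ^ _),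
        map_mul, map_mul, LinearMap.add_apply, Module.End.mul_apply, Module.End.mul_apply, hpv,
        Nat.find_spec hex]
      simp
    have hle := Nat.find_min' hex hgl
    have hli : l = Nat.find hex := le_antisymm hl hle
    have hdvd : g ^ Nat.find hex ∣ p := by
      rw [← hli]
      exact hass.symm.dvd.trans (hli ▸ EuclideanDomain.gcd_dvd_left p (g ^ Nat.find hex))
    exact absurd (degree_le_of_dvd hdvd hp0) (not_le.mpr hp)

/-- A linearly independent family extends to coordinates on the whole space. -/
theorem exists_linearEquiv_single_eq {j k : ℕ} (hV : Module.finrank F V = j + k)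
    (t : {t : Fin j → V // LinearIndependent F t}) :
    ∃ e : ((Fin j → F) × (Fin k → F)) ≃ₗ[F] V, ∀ s, e (Pi.single s 1, 0) = t.1 s := by
  let b := Module.Basis.span t.2
  obtain ⟨C, hC⟩ := Submodule.exists_isCompl (Submodule.span F (Set.range t.1))
  have hdim : Module.finrank F C = k := by
    have h1 := Submodule.finrank_add_eq_of_isCompl hC
    have h2 := finrank_span_eq_card t.2
    rw [Fintype.card_fin] at h2
    omega
  let eC : (Fin k → F) ≃ₗ[F] C := LinearEquiv.ofFinrankEq _ _ (by simp [hdim])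
  refine ⟨(b.equivFun.symm.prodCongr eC).trans (Submodule.prodEquivOfIsCompl _ _ hC), fun s => ?_⟩
  simp [b, Module.Basis.span_apply]

variable [Finite F]

/-- The pair `(φ, v)` is encoded by the independent tuple `v, φ v, ..., φ^(j-1) v` and the two
blocks of `φ` on the complementary coordinates: an arbitrary off-diagonal block and a diagonal one
with characteristic polynomial `f`. The coordinates `e` depend only on the tuple, and `φ^j v` is
forced by `h`, so nothing is lost. -/
theorem card_pairs_isVectorMinpoly_le {h f : F[X]} {j k : ℕ} (hmon : h.Monic)
    (hj : h.natDegree = j) (hj0 : j ≠ 0) (hV : Module.finrank F V = j + k) :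
    Nat.card {x : Module.End F V × V // x.1.charpoly = h * f ∧ IsVectorMinpoly x.1 x.2 h} ≤
      (∏ i : Fin j, (Nat.card F ^ (j + k) - Nat.card F ^ (i : ℕ))) *
        (Nat.card F ^ (j * k) *
          Nat.card {Y : Module.End F (Fin k → F) // Y.charpoly = f}) := by
  have := finite_of_finiteDimensional F V
  have hdeg : h.degree = j := by rw [degree_eq_natDegree hmon.ne_zero, hj]
  choose e he using fun t : {t : Fin j → V // LinearIndependent F t} =>
    exists_linearEquiv_single_eq hV t
  have hcardHom : Nat.card ((Fin k → F) →ₗ[F] (Fin j → F)) = Nat.card F ^ (j * k) := by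
    rw [Module.natCard_eq_pow_finrank (K := F), Module.finrank_linearMap]
    simp [mul_comm]
  rw [← card_linearIndependent_fin hV (Nat.le_add_right _ _), ← hcardHom, ← Nat.card_prod,
    ← Nat.card_prod]
  let t : {x : Module.End F V × V // x.1.charpoly = h * f ∧ IsVectorMinpoly x.1 x.2 h} →
      {t : Fin j → V // LinearIndependent F t} := fun x =>
    ⟨fun s => (x.1.1 ^ (s : ℕ)) x.1.2, x.2.2.linearIndependent hdeg⟩
  have het : ∀ x s, e (t x) (Pi.single s 1, 0) = (x.1.1 ^ (s : ℕ)) x.1.2 := fun x s => he (t x) s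
  refine Nat.card_le_card_of_injective (fun x => (t x,
    (LinearMap.fst F _ _ ∘ₗ (e (t x)).symm.conj x.1.1 ∘ₗ LinearMap.inr F _ _,
      ⟨LinearMap.snd F _ _ ∘ₗ (e (t x)).symm.conj x.1.1 ∘ₗ LinearMap.inr F _ _, ?_⟩))) ?_
  · have h₁ := charpoly_of_snd_comp_inl_eq_zero ((e (t x)).symm.conj x.1.1) (fun y => by
      simpa [LinearEquiv.conj_apply] using conj_symm_inl_snd x.2.2 hmon hj (het x) y)
    rw [LinearEquiv.charpoly_conj, x.2.1,
      charpoly_fst_conj_inl x.2.2 hmon hj hj0 (het x)] at h₁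
    exact (mul_left_cancel₀ hmon.ne_zero h₁).symm
  · intro x x' hxx'
    simp only [Prod.mk.injEq, Subtype.mk.injEq] at hxx'
    obtain ⟨ht, hB, hY⟩ := hxx'
    have htt : ∀ s : Fin j, (x.1.1 ^ (s : ℕ)) x.1.2 = (x'.1.1 ^ (s : ℕ)) x'.1.2 :=
      fun s => congrFun (congrArg Subtype.val ht) s
    have hv : x.1.2 = x'.1.2 := by simpa using htt ⟨0, Nat.pos_of_ne_zero hj0⟩
    have hjv : (x.1.1 ^ j) x.1.2 = (x'.1.1 ^ j) x'.1.2 := by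
      rw [pow_natDegree_apply_eq x.2.2 hmon hj, pow_natDegree_apply_eq x'.2.2 hmon hj]
      simp_rw [htt]
    rw [← ht] at hB hY
    have hφ : x.1.1 ∘ₗ (e (t x)).toLinearMap = x'.1.1 ∘ₗ (e (t x)).toLinearMap := by
      refine LinearMap.prod_ext (linearMap_ext_of_single fun s => ?_) (LinearMap.ext fun y => ?_)
      · simp only [LinearMap.comp_apply, LinearMap.inl_apply, LinearEquiv.coe_coe, het]
        conv_rhs => rw [htt s]
        rw [← Module.End.mul_apply, ← pow_succ', ← Module.End.mul_apply, ← pow_succ']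
        rcases Nat.lt_or_ge (s + 1) j with hs | hs
        · exact htt ⟨s + 1, hs⟩
        · rw [show (s : ℕ) + 1 = j by omega, hjv]
      · apply (e (t x)).symm.injective
        ext1
        · simpa [LinearEquiv.conj_apply] using LinearMap.congr_fun hB y
        · simpa [LinearEquiv.conj_apply] using LinearMap.congr_fun hY y
    apply Subtype.ext
    refine Prod.ext ?_ hv
    ext y
    simpa using LinearMap.congr_fun hφ ((e (t x)).symm y)

end PrimePower
-- Counting endomorphisms, cyclic or not, with prime power characteristic polynomial
section PrimePower

variable {F : Type*} [Field F]
variable {V : Type*} [AddCommGroup V] [Module F V] [FiniteDimensional F V]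

/-- Every monic polynomial is the characteristic polynomial of a cyclic endomorphism. -/
theorem exists_cyclic_end_charpoly_eq {f : F[X]} (hf : f.Monic)
    (hV : Module.finrank F V = f.natDegree) :
    ∃ (φ : Module.End F V) (u : V), φ.charpoly = f ∧ (∀ w, ∃ p : F[X], aeval φ p u = w) ∧
      ∀ p : F[X], aeval φ p u = 0 → f ∣ p := by
  let pb := AdjoinRoot.powerBasis hf.ne_zero
  have : FiniteDimensional F (AdjoinRoot f) := pb.finite
  have hdim : Module.finrank F (AdjoinRoot f) = f.natDegree := by
    rw [pb.finrank, AdjoinRoot.powerBasis_dim]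
  let e : AdjoinRoot f ≃ₗ[F] V := LinearEquiv.ofFinrankEq _ _ (hdim.trans hV.symm)
  let ψ : Module.End F (AdjoinRoot f) := Algebra.lmul F _ (AdjoinRoot.root f)
  have hψ : ∀ p : F[X], aeval ψ p 1 = AdjoinRoot.mk f p := by
    intro p
    have : aeval ψ p = Algebra.lmul F _ (aeval (AdjoinRoot.root f) p) :=
      Polynomial.aeval_algHom_apply (Algebra.lmul F (AdjoinRoot f)) (AdjoinRoot.root f) p
    rw [this, AdjoinRoot.aeval_eq]
    simp
  have hφ : ∀ p : F[X], aeval (e.conj ψ) p (e 1) = e (AdjoinRoot.mk f p) := by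
    intro p
    rw [aeval_conj_apply, hψ]
  refine ⟨e.conj ψ, e 1, ?_, fun w => ?_, fun p hp => ?_⟩
  · have h₁ : f ∣ (e.conj ψ).charpoly := by
      rw [← AdjoinRoot.mk_eq_zero]
      apply e.injective
      rw [← hφ, LinearMap.aeval_self_charpoly, LinearMap.zero_apply, map_zero]
    refine (eq_of_monic_of_dvd_of_natDegree_le hf (LinearMap.charpoly_monic _) h₁ ?_)
    rw [LinearMap.charpoly_natDegree, hV]
  · obtain ⟨p, hp⟩ := AdjoinRoot.mk_surjective (e.symm w)
    exact ⟨p, by rw [hφ, hp, e.apply_symm_apply]⟩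
  · rw [hφ, LinearEquiv.map_eq_zero_iff] at hp
    exact AdjoinRoot.mk_eq_zero.mp hp

/-- With `u` a cyclic vector, the image of `g(φ)^m` consists of the vectors `g(φ)^m p(φ) u`, and `p`
may be reduced modulo `g` because `g^(m+1)` kills everything. So the rank is at most `deg g`. -/
theorem le_finrank_ker_aeval_pow {φ : Module.End F V} {g : F[X]} (hmon : g.Monic) {m : ℕ}
    (hφ : φ.charpoly = g ^ (m + 1)) (hc : HasCyclicVector φ) :
    g.natDegree * m ≤ Module.finrank F (LinearMap.ker (aeval φ (g ^ m))) := by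
  obtain ⟨u, hu⟩ := hc
  have hdim : Module.finrank F V = g.natDegree * (m + 1) := by
    rw [← φ.charpoly_natDegree, hφ, natDegree_pow, mul_comm]
  let T : F[X] →ₗ[F] V := (LinearMap.applyₗ u) ∘ₗ (aeval φ).toLinearMap
  have hT : ∀ p, T p = aeval φ p u := fun p => rfl
  have hle : LinearMap.range (aeval φ (g ^ m)) ≤
      ((degreeLT F g.natDegree).map T).map (aeval φ (g ^ m)) := by
    rintro _ ⟨w, rfl⟩
    obtain ⟨p, rfl⟩ := hu w
    refine ⟨T (p %ₘ g), ⟨p %ₘ g, ?_, rfl⟩, ?_⟩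
    · rw [SetLike.mem_coe, mem_degreeLT, ← degree_eq_natDegree hmon.ne_zero]
      exact degree_modByMonic_lt _ hmon
    · have hz : aeval φ (g ^ m) (aeval φ (g * (p /ₘ g)) u) = 0 := by
        rw [← Module.End.mul_apply, ← map_mul, ← mul_assoc, ← pow_succ, ← hφ, map_mul,
          LinearMap.aeval_self_charpoly, zero_mul, LinearMap.zero_apply]
      conv_rhs => rw [← modByMonic_add_div p g]
      rw [map_add, LinearMap.add_apply, map_add, hz, add_zero, hT]
  have hfin : FiniteDimensional F (degreeLT F g.natDegree) :=
    Module.Finite.equiv (degreeLTEquiv F g.natDegree).symm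
  have h₁ := Submodule.finrank_mono hle
  have h₂ := Submodule.finrank_map_le (aeval φ (g ^ m)) ((degreeLT F g.natDegree).map T)
  have h₃ := Submodule.finrank_map_le T (degreeLT F g.natDegree)
  have h₄ : Module.finrank F (degreeLT F g.natDegree) = g.natDegree := by
    rw [(degreeLTEquiv F g.natDegree).finrank_eq]; simp
  have h₅ := LinearMap.finrank_range_add_finrank_ker (aeval φ (g ^ m))
  rw [hdim, mul_add] at h₅
  omega

variable [Finite F]

theorem card_not_mem_ker_le {φ : Module.End F V} {g : F[X]} (hmon : g.Monic) {m : ℕ}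
    (hφ : φ.charpoly = g ^ (m + 1)) (hc : HasCyclicVector φ) :
    Nat.card {v : V // aeval φ (g ^ m) v ≠ 0} ≤
      Nat.card F ^ (g.natDegree * (m + 1)) - Nat.card F ^ (g.natDegree * m) := by
  have : Finite V := finite_of_finiteDimensional F V
  have hdim : Module.finrank F V = g.natDegree * (m + 1) := by
    rw [← φ.charpoly_natDegree, hφ, natDegree_pow, mul_comm]
  have h₁ : Nat.card {v : V // aeval φ (g ^ m) v = 0} +
      Nat.card {v : V // aeval φ (g ^ m) v ≠ 0} = Nat.card V := by
    classical
    rw [← Nat.card_sum (α := {v : V // aeval φ (g ^ m) v = 0})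
      (β := {v : V // aeval φ (g ^ m) v ≠ 0})]
    exact Nat.card_congr (Equiv.sumCompl fun v : V => aeval φ (g ^ m) v = 0)
  have h₂ : Nat.card F ^ (g.natDegree * m) ≤ Nat.card {v : V // aeval φ (g ^ m) v = 0} := by
    have : Nat.card {v : V // aeval φ (g ^ m) v = 0} =
        Nat.card (LinearMap.ker (aeval φ (g ^ m))) := rfl
    rw [this, Module.natCard_eq_pow_finrank (K := F) (V := LinearMap.ker (aeval φ (g ^ m)))]
    exact Nat.pow_le_pow_right (Nat.card_pos (α := F)) (le_finrank_ker_aeval_pow hmon hφ hc)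
  rw [Module.natCard_eq_pow_finrank (K := F) (V := V), hdim] at h₁
  omega

/-- A lower bound for the number of cyclic endomorphisms with characteristic polynomial a power
of an irreducible polynomial. -/
theorem cardGL_le_card_cyclic_mul {g : F[X]} (hmon : g.Monic) (hirr : Irreducible g) {m : ℕ}
    (hV : Module.finrank F V = g.natDegree * (m + 1)) :
    cardGL (Nat.card F) (g.natDegree * (m + 1)) ≤
      Nat.card {φ : Module.End F V // φ.charpoly = g ^ (m + 1) ∧ HasCyclicVector φ} *
        (Nat.card F ^ (g.natDegree * (m + 1)) - Nat.card F ^ (g.natDegree * m)) := by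
  have : Finite V := finite_of_finiteDimensional F V
  obtain ⟨ψ, u, hψ, hu, hann⟩ := exists_cyclic_end_charpoly_eq (V := V) (hmon.pow (m + 1))
    (by rw [hV, natDegree_pow, mul_comm])
  have hne : aeval ψ (g ^ m) u ≠ 0 := by
    intro h0
    have := hann _ h0
    rw [pow_dvd_pow_iff hirr.ne_zero hirr.not_isUnit] at this
    omega
  rw [← card_linearEquiv (F := F) (V := V) (W := V) hV hV]
  let S := {φ : Module.End F V // φ.charpoly = g ^ (m + 1) ∧ HasCyclicVector φ}
  -- Orbit counting without stabilisers: `a` is recovered from `a ψ a⁻¹` and `a u`, as `a (p(ψ) u) =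
  -- p(a ψ a⁻¹) (a u)` and `u` is cyclic. The image `a u` avoids the kernel of `g^m`, which bounds
  -- each fibre.
  have hinj : Function.Injective (fun a : V ≃ₗ[F] V =>
      ((⟨⟨a.conj ψ, by rw [LinearEquiv.charpoly_conj, hψ], HasCyclicVector.conj a ⟨u, hu⟩⟩,
        ⟨a u, by rw [aeval_conj_apply]; simpa [-map_pow] using hne⟩⟩ :
          Σ φ : S, {v : V // aeval φ.1 (g ^ m) v ≠ 0}))) := by
    intro a b hab
    have h₁ : a.conj ψ = b.conj ψ := congrArg (fun x => x.1.1) hab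
    have h₂ : a u = b u := congrArg (fun x => x.2.1) hab
    ext w
    obtain ⟨p, rfl⟩ := hu w
    rw [← aeval_conj_apply, ← aeval_conj_apply, h₁, h₂]
  refine (Nat.card_le_card_of_injective _ hinj).trans ?_
  have := Fintype.ofFinite S
  rw [Nat.card_sigma, Nat.card_eq_fintype_card (α := S)]
  exact (Finset.sum_le_card_nsmul _ _ _ fun φ _ => card_not_mem_ker_le hmon φ.2.1 φ.2.2).trans
    (by rw [Finset.card_univ, smul_eq_mul])

/-- Pairs of an endomorphism and a nonzero vector `v` are counted according to the annihilator
`g^(i+1)` of `v`. This bounds the count for `g^m` by those for smaller powers of `g`. -/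
theorem card_charpoly_eq_pow_mul_le {g : F[X]} (hmon : g.Monic) (hirr : Irreducible g) (m : ℕ) :
    Nat.card {φ : Module.End F (Fin (g.natDegree * m) → F) // φ.charpoly = g ^ m} *
        (Nat.card F ^ (g.natDegree * m) - 1) ≤
      ∑ i : Fin m, (∏ s : Fin (g.natDegree * (i + 1)),
          (Nat.card F ^ (g.natDegree * m) - Nat.card F ^ (s : ℕ))) *
        (Nat.card F ^ (g.natDegree * (i + 1) * (g.natDegree * (m - 1 - i))) *
          Nat.card {Y : Module.End F (Fin (g.natDegree * (m - 1 - i)) → F) //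
            Y.charpoly = g ^ (m - 1 - i)}) := by
  let V := Fin (g.natDegree * m) → F
  have hne : Nat.card {v : V // v ≠ 0} = Nat.card F ^ (g.natDegree * m) - 1 := by
    classical
    have := Fintype.ofFinite F
    rw [Nat.card_eq_fintype_card, Fintype.card_subtype_compl, Fintype.card_subtype_eq]
    simp [V]
  rw [← hne, ← Nat.card_prod]
  let S : Fin m → Type _ := fun i => {x : Module.End F V × V //
    x.1.charpoly = g ^ ((i : ℕ) + 1) * g ^ (m - 1 - i) ∧
      IsVectorMinpoly x.1 x.2 (g ^ ((i : ℕ) + 1))}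
  have hex : ∀ x : {φ : Module.End F V // φ.charpoly = g ^ m} × {v : V // v ≠ 0},
      ∃ i : Fin m, IsVectorMinpoly x.1.1 x.2.1 (g ^ ((i : ℕ) + 1)) := by
    intro x
    obtain ⟨i, h1, h2, h3⟩ := exists_isVectorMinpoly hirr x.1.2 x.2.2
    exact ⟨⟨i - 1, by omega⟩, by rwa [show i - 1 + 1 = i by omega]⟩
  choose i hi using hex
  have hinj : Function.Injective (fun x => (⟨i x, ⟨(x.1.1, x.2.1), by
      rw [← pow_add, x.1.2]; congr 1; omega, hi x⟩⟩ : Σ i, S i)) := by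
    intro x y hxy
    have h := congrArg (fun z : Σ i, S i => z.2.1) hxy
    exact Prod.ext (Subtype.ext (congrArg Prod.fst h)) (Subtype.ext (congrArg Prod.snd h))
  refine (Nat.card_le_card_of_injective _ hinj).trans ?_
  rw [Nat.card_sigma]
  refine Finset.sum_le_sum fun i _ => ?_
  have hsum : g.natDegree * m = g.natDegree * ((i : ℕ) + 1) + g.natDegree * (m - 1 - i) := by
    rw [← mul_add]; congr 1; omega
  have := card_pairs_isVectorMinpoly_le (V := V) (h := g ^ ((i : ℕ) + 1)) (f := g ^ (m - 1 - i))
    (j := g.natDegree * ((i : ℕ) + 1)) (k := g.natDegree * (m - 1 - i)) (hmon.pow _)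
    (by rw [natDegree_pow, mul_comm])
    (Nat.mul_ne_zero (hirr.natDegree_pos).ne' (Nat.succ_ne_zero _)) (by simpa [V] using hsum)
  rw [← hsum] at this
  exact this

end PrimePower

/-! ### The products `ω(m, Q)` -/

section Omega

theorem omega_zero (Q : ℝ) : omega 0 Q = 1 := by simp [omega]

theorem omega_succ (m : ℕ) (Q : ℝ) : omega (m + 1) Q = omega m Q * (1 - (Q ^ (m + 1))⁻¹) := by
  rw [omega, Finset.prod_Icc_succ_top (by omega), omega]

theorem omega_pos {Q : ℝ} (hQ : 1 < Q) (m : ℕ) : 0 < omega m Q := by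
  refine Finset.prod_pos fun i hi => ?_
  rw [sub_pos]
  exact inv_lt_one_of_one_lt₀ (one_lt_pow₀ hQ (by have := (Finset.mem_Icc.mp hi).1; omega))

theorem cardGL_eq {q : ℕ} (hq : 1 < q) (n : ℕ) :
    (cardGL q n : ℝ) = (q : ℝ) ^ n ^ 2 * omega n q := by
  have hq0 : (0 : ℝ) < q := by positivity
  rw [cardGL, omega, Nat.cast_prod, pow_two, pow_mul]
  have h : ∀ i : Fin n, ((q ^ n - q ^ (i : ℕ) : ℕ) : ℝ) = (q : ℝ) ^ n *
      (1 - ((q : ℝ) ^ (n - i))⁻¹) := by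
    intro i
    rw [Nat.cast_sub (Nat.pow_le_pow_right hq.le i.2.le), Nat.cast_pow, Nat.cast_pow, mul_sub,
      mul_one, ← pow_sub₀ _ hq0.ne' (Nat.sub_le _ _), Nat.sub_sub_self i.2.le]
  simp_rw [h]
  rw [Finset.prod_mul_distrib, Finset.prod_const, Finset.card_univ, Fintype.card_fin]
  congr 1
  rw [Fin.prod_univ_eq_prod_range (fun i => 1 - ((q : ℝ) ^ (n - i))⁻¹) n,
    ← Finset.prod_range_reflect, show Finset.Icc 1 n = Finset.Ico 1 (n + 1) from rfl,
    Finset.prod_Ico_eq_prod_range, Nat.add_sub_cancel]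
  refine Finset.prod_congr rfl fun j hj => ?_
  have := Finset.mem_range.mp hj
  rw [show n - (n - 1 - j) = 1 + j by omega]

/-- The sum telescopes: `1/ω(m+1) - 1/ω(m) = 1/(Q^(m+1) ω(m+1))`. It solves the recursion for the
number of endomorphisms with characteristic polynomial `g^m`. -/
theorem sum_inv_pow_mul_omega {Q : ℝ} (hQ : 1 < Q) (m : ℕ) :
    ∑ i ∈ Finset.range (m + 1), (Q ^ i * omega i Q)⁻¹ = (omega m Q)⁻¹ := by
  induction m with
  | zero => simp
  | succ m ih =>
    rw [Finset.sum_range_succ, ih, omega_succ]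
    have h1 := (omega_pos hQ m).ne'
    have h2 : (1 - (Q ^ (m + 1))⁻¹) ≠ 0 := by
      rw [sub_ne_zero]
      exact (inv_lt_one_of_one_lt₀ (one_lt_pow₀ hQ (by omega))).ne'
    have h3 : Q ^ (m + 1) ≠ 0 := by positivity
    have h4 : Q ^ (m + 1) - 1 ≠ 0 := by
      rw [sub_ne_zero]
      exact (one_lt_pow₀ hQ (by omega)).ne'
    field_simp
    ring

end Omega

/-! ### Proportions relative to the general linear group -/

section PrimePower

variable {F : Type*} [Field F] [Finite F]

/-- The proportion of endomorphisms with characteristic polynomial `g ^ m`, measured in units of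
the order of the general linear group. -/
theorem card_charpoly_eq_pow_div_le {g : F[X]} (hmon : g.Monic) (hirr : Irreducible g) (m : ℕ) :
    (Nat.card {φ : Module.End F (Fin (g.natDegree * m) → F) // φ.charpoly = g ^ m} : ℝ) /
        cardGL (Nat.card F) (g.natDegree * m) ≤
      ((((Nat.card F : ℝ) ^ g.natDegree) ^ m) * omega m ((Nat.card F : ℝ) ^ g.natDegree))⁻¹ := by
  set q := Nat.card F with hq
  set d := g.natDegree with hd
  have hq1 : 1 < q := Finite.one_lt_card
  have hd0 : d ≠ 0 := hirr.natDegree_pos.ne'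
  set Q : ℝ := (q : ℝ) ^ d with hQ
  have hQ1 : 1 < Q := one_lt_pow₀ (by exact_mod_cast hq1) hd0
  induction m using Nat.strong_induction_on with
  | _ m ih =>
  rcases Nat.eq_zero_or_pos m with rfl | hm
  · have hsub : Nat.card {φ : Module.End F (Fin (d * 0) → F) // φ.charpoly = g ^ 0} ≤ 1 := by
      have : Subsingleton (Module.End F (Fin (d * 0) → F)) := by
        rw [mul_zero]; infer_instance
      exact Finite.card_le_one_iff_subsingleton.mpr inferInstance
    have hg1 : cardGL q (d * 0) = 1 := by simp [cardGL]
    rw [hg1, pow_zero, omega_zero]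
    simpa using hsub
  have key := card_charpoly_eq_pow_mul_le hmon hirr m
  have hGL : ∀ n, (0 : ℝ) < cardGL q n := fun n => by exact_mod_cast cardGL_pos hq1 n
  have hterm : ∀ i : Fin m, (((∏ s : Fin (d * (i + 1)), (q ^ (d * m) - q ^ (s : ℕ))) *
        (q ^ (d * (i + 1) * (d * (m - 1 - i))) *
          Nat.card {Y : Module.End F (Fin (d * (m - 1 - i)) → F) //
            Y.charpoly = g ^ (m - 1 - i)}) : ℕ) : ℝ) ≤
      cardGL q (d * m) * (Q ^ (m - 1 - i) * omega (m - 1 - i) Q)⁻¹ := by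
    intro i
    have hsum : d * m = d * ((i : ℕ) + 1) + d * (m - 1 - i) := by
      rw [← mul_add]; congr 1; omega
    have h₁ := prod_mul_cardGL q (d * ((i : ℕ) + 1)) (d * (m - 1 - i))
    rw [← hsum] at h₁
    have h₂ := ih (m - 1 - i) (by omega)
    rw [div_le_iff₀ (hGL _)] at h₂
    rw [← h₁]
    generalize (∏ s : Fin (d * ((i : ℕ) + 1)), (q ^ (d * m) - q ^ (s : ℕ))) = a
    generalize q ^ (d * ((i : ℕ) + 1) * (d * (m - 1 - i))) = b
    rw [Nat.cast_mul, Nat.cast_mul, Nat.cast_mul, Nat.cast_mul, mul_assoc, mul_assoc]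
    gcongr
    exact h₂.trans_eq (mul_comm _ _)
  have hsum : ((∑ i : Fin m, (∏ s : Fin (d * (i + 1)), (q ^ (d * m) - q ^ (s : ℕ))) *
        (q ^ (d * (i + 1) * (d * (m - 1 - i))) *
          Nat.card {Y : Module.End F (Fin (d * (m - 1 - i)) → F) //
            Y.charpoly = g ^ (m - 1 - i)}) : ℕ) : ℝ) ≤
      cardGL q (d * m) * (omega (m - 1) Q)⁻¹ := by
    -- After the reflection `i ↦ m - 1 - i` the inductive bounds sum to `1/ω(m-1)`. Dividing by the
    -- number `Q^m - 1` of nonzero vectors gives `1/(Q^m ω(m))`, as recorded in `hω`.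
    rw [← sum_inv_pow_mul_omega hQ1, Nat.sub_add_cancel hm, Finset.mul_sum,
      ← Finset.sum_range_reflect, Finset.sum_range, Nat.cast_sum]
    exact Finset.sum_le_sum fun i _ => hterm i
  have h₃ : ((Nat.card {φ : Module.End F (Fin (d * m) → F) // φ.charpoly = g ^ m} *
      (q ^ (d * m) - 1) : ℕ) : ℝ) ≤ cardGL q (d * m) * (omega (m - 1) Q)⁻¹ :=
    le_trans (by exact_mod_cast key) hsum
  rw [Nat.cast_mul, Nat.cast_sub (Nat.one_le_pow _ _ (by omega)), Nat.cast_pow, Nat.cast_one,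
    pow_mul, ← hQ] at h₃
  have hQm : 0 < Q ^ m - 1 := by
    rw [sub_pos]; exact one_lt_pow₀ hQ1 hm.ne'
  have hω : (Q ^ m * omega m Q)⁻¹ = (omega (m - 1) Q)⁻¹ / (Q ^ m - 1) := by
    obtain ⟨k, rfl⟩ : ∃ k, m = k + 1 := ⟨m - 1, by omega⟩
    rw [omega_succ, Nat.add_sub_cancel]
    have h1 := (omega_pos hQ1 k).ne'
    have h3 : Q ^ (k + 1) ≠ 0 := by positivity
    have h4 := hQm.ne'
    have h2 : Q ^ (k + 1) * (omega k Q * (1 - (Q ^ (k + 1))⁻¹)) =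
        omega k Q * (Q ^ (k + 1) - 1) := by
      field_simp
    rw [h2, mul_inv, div_eq_mul_inv]
  rw [hω, div_le_div_iff₀ (hGL _) hQm, mul_comm (omega (m - 1) Q)⁻¹]
  exact h₃

/-- The proportion of noncyclic endomorphisms with characteristic polynomial `g ^ m`. -/
theorem card_noncyclic_div_le {g : F[X]} (hmon : g.Monic) (hirr : Irreducible g) {m : ℕ}
    (hm : m ≠ 0) :
    (Nat.card {φ : Module.End F (Fin (g.natDegree * m) → F) //
        φ.charpoly = g ^ m ∧ ¬ HasCyclicVector φ} : ℝ) /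
        cardGL (Nat.card F) (g.natDegree * m) ≤
      (((Nat.card F : ℝ) ^ g.natDegree) ^ m)⁻¹ *
        ((omega m ((Nat.card F : ℝ) ^ g.natDegree))⁻¹ -
          (1 - ((Nat.card F : ℝ) ^ g.natDegree)⁻¹)⁻¹) := by
  obtain ⟨k, rfl⟩ : ∃ k, m = k + 1 := ⟨m - 1, by omega⟩
  have h₁ := card_charpoly_eq_pow_div_le hmon hirr (k + 1)
  have h₂ := cardGL_le_card_cyclic_mul (V := Fin (g.natDegree * (k + 1)) → F) hmon hirr (m := k)
    (by simp)
  have h₃ : Nat.card {φ : Module.End F (Fin (g.natDegree * (k + 1)) → F) //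
        φ.charpoly = g ^ (k + 1)} =
      Nat.card {φ : Module.End F (Fin (g.natDegree * (k + 1)) → F) //
        φ.charpoly = g ^ (k + 1) ∧ HasCyclicVector φ} +
      Nat.card {φ : Module.End F (Fin (g.natDegree * (k + 1)) → F) //
        φ.charpoly = g ^ (k + 1) ∧ ¬ HasCyclicVector φ} := by
    classical
    rw [← Nat.card_sum]
    refine Nat.card_congr ((Equiv.sumCompl (fun φ : {φ : Module.End F
      (Fin (g.natDegree * (k + 1)) → F) // φ.charpoly = g ^ (k + 1)} =>
        HasCyclicVector φ.1)).symm.trans (Equiv.sumCongr ?_ ?_))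
    · exact Equiv.subtypeSubtypeEquivSubtypeInter _ _
    · exact Equiv.subtypeSubtypeEquivSubtypeInter _ (fun φ => ¬ HasCyclicVector φ)
  rw [h₃] at h₁
  set q := Nat.card F with hq
  set d := g.natDegree with hd
  have hq1 : 1 < q := Finite.one_lt_card
  have hd0 : d ≠ 0 := hirr.natDegree_pos.ne'
  have hGL : (0 : ℝ) < cardGL q (d * (k + 1)) := by exact_mod_cast cardGL_pos hq1 _
  have h₄ : (cardGL q (d * (k + 1)) : ℝ) ≤
      Nat.card {φ : Module.End F (Fin (d * (k + 1)) → F) //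
        φ.charpoly = g ^ (k + 1) ∧ HasCyclicVector φ} *
        (((q : ℝ) ^ d) ^ (k + 1) - ((q : ℝ) ^ d) ^ k) := by
    have := (Nat.cast_le (α := ℝ)).mpr h₂
    rw [Nat.cast_mul, Nat.cast_sub (Nat.pow_le_pow_right hq1.le
      (Nat.mul_le_mul_left _ (Nat.le_succ k)))] at this
    simpa [pow_mul] using this
  set Q : ℝ := (q : ℝ) ^ d with hQ
  have hQ1 : 1 < Q := one_lt_pow₀ (by exact_mod_cast hq1) hd0
  have hQ0 : 0 < Q := by linarith
  have h₅ : Q ^ (k + 1) - Q ^ k = Q ^ (k + 1) * (1 - Q⁻¹) := by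
    field_simp
    ring
  have hpos : 0 < Q ^ (k + 1) * (1 - Q⁻¹) :=
    mul_pos (by positivity) (sub_pos.mpr (inv_lt_one_of_one_lt₀ hQ1))
  rw [h₅, ← div_le_iff₀ hpos] at h₄
  rw [Nat.cast_add, add_div] at h₁
  have h₆ : (Q ^ (k + 1) * (1 - Q⁻¹))⁻¹ ≤
      (Nat.card {φ : Module.End F (Fin (d * (k + 1)) → F) //
        φ.charpoly = g ^ (k + 1) ∧ HasCyclicVector φ} : ℝ) / cardGL q (d * (k + 1)) := by
    rw [le_div_iff₀ hGL, mul_comm, ← div_eq_mul_inv]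
    exact h₄
  rw [mul_sub, ← mul_inv, ← mul_inv]
  linarith

end PrimePower

/-! ### The recursive inequality for the density of uncyclic matrices -/

section Recursion

variable {F : Type*} [Field F]

/-- The weight of the noncyclic types of size `m` relative to a polynomial whose residue field has
`Q` elements. -/
noncomputable def noncyclicWeight (Q : ℝ) (m : ℕ) : ℝ := (omega m Q)⁻¹ - (1 - Q⁻¹)⁻¹

/-- The number of uncyclic matrices relative to the order of the general linear group. -/
noncomputable def uncDensity (n : ℕ) (F : Type*) [Field F] : ℝ :=
  (Nat.card F : ℝ) ^ n * unc n F / cardGL (Nat.card F) n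

theorem uncDensity_nonneg (n : ℕ) (F : Type*) [Field F] : 0 ≤ uncDensity n F := by
  unfold uncDensity; positivity

theorem uncDensity_zero : uncDensity 0 F = 1 := by
  have h : unc 0 F = 1 := by
    rw [unc_eq, Nat.card_eq_one_iff_unique]
    have : Subsingleton (Module.End F (Fin 0 → F)) := inferInstance
    refine ⟨inferInstance, ⟨⟨0, fun g _ hirr hd => ?_⟩⟩⟩
    exfalso
    refine hirr.not_isUnit (isUnit_of_dvd_one ?_)
    convert hd
    exact (LinearMap.charpoly_monic (0 : Module.End F (Fin 0 → F))).natDegree_eq_zero.mp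
      (by rw [LinearMap.charpoly_natDegree]; simp) |>.symm
  simp [uncDensity, h, cardGL]

variable [Finite F]

theorem card_endIsUncyclic_multiplicity_density_le {g : F[X]} (hmon : g.Monic)
    (hirr : Irreducible g) {n m : ℕ} (hm : m ≠ 0) (hn : g.natDegree * m ≤ n) :
    (Nat.card F : ℝ) ^ n * Nat.card {φ : Module.End F (Fin n → F) //
        EndIsUncyclic φ ∧ multiplicity g φ.charpoly = m} / cardGL (Nat.card F) n ≤
      noncyclicWeight ((Nat.card F : ℝ) ^ g.natDegree) m *
        uncDensity (n - g.natDegree * m) F := by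
  obtain ⟨k, rfl⟩ := Nat.exists_eq_add_of_le hn
  rw [Nat.add_sub_cancel_left, uncDensity]
  have h₁ := card_endIsUncyclic_multiplicity_mul_le (F := F)
    (V := Fin (g.natDegree * m + k) → F) (k := k) hmon hirr hm (by simp)
  have h₂ := card_noncyclic_div_le hmon hirr hm
  have hq1 : 1 < Nat.card F := Finite.one_lt_card
  have hGL : ∀ n, (0 : ℝ) < cardGL (Nat.card F) n := fun n => by
    exact_mod_cast cardGL_pos hq1 n
  have hq0 : (0 : ℝ) < Nat.card F := by positivity
  have h₃ := (Nat.cast_le (α := ℝ)).mpr h₁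
  simp only [Nat.cast_mul] at h₃
  rw [div_le_iff₀ (hGL _)] at h₂
  rw [noncyclicWeight]
  generalize (Nat.card {φ : Module.End F (Fin (g.natDegree * m + k) → F) //
        EndIsUncyclic φ ∧ multiplicity g φ.charpoly = m} : ℝ) = T at *
  generalize (Nat.card {φ : Module.End F (Fin (g.natDegree * m) → F) //
        φ.charpoly = g ^ m ∧ ¬ HasCyclicVector φ} : ℝ) = N at *
  have hA := hGL (g.natDegree * m)
  have hB := hGL k
  have hC := hGL (g.natDegree * m + k)
  generalize (cardGL (Nat.card F) (g.natDegree * m) : ℝ) = A at *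
  generalize (cardGL (Nat.card F) k : ℝ) = B at *
  generalize (cardGL (Nat.card F) (g.natDegree * m + k) : ℝ) = D at *
  rw [← pow_mul] at h₂
  generalize (omega m ((Nat.card F : ℝ) ^ g.natDegree))⁻¹ -
          (1 - ((Nat.card F : ℝ) ^ g.natDegree)⁻¹)⁻¹ = w at *
  have hU : (0 : ℝ) ≤ unc k F := Nat.cast_nonneg _
  generalize (unc k F : ℝ) = U at *
  have hP : (0 : ℝ) < (Nat.card F : ℝ) ^ (g.natDegree * m) := by positivity
  have hK : (0 : ℝ) < (Nat.card F : ℝ) ^ k := by positivity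
  -- The normalising power `q^n` splits as `q^(dm) q^k`: the first factor cancels the `Q^(-m)` in
  -- the noncyclic proportion, the second belongs to the density of size `k`.
  rw [pow_add]
  generalize (Nat.card F : ℝ) ^ (g.natDegree * m) = P at *
  generalize (Nat.card F : ℝ) ^ k = K at *
  have h₄ : T * (A * B) ≤ D * (P⁻¹ * w * A * U) :=
    h₃.trans (by gcongr)
  have h₅ : T * B ≤ D * (P⁻¹ * w * U) := by
    refine le_of_mul_le_mul_right ?_ hA
    linarith
  rw [div_le_iff₀ hC, mul_div_assoc', div_mul_eq_mul_div, le_div_iff₀ hB]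
  calc P * K * T * B = P * K * (T * B) := by ring
    _ ≤ P * K * (D * (P⁻¹ * w * U)) := by gcongr
    _ = w * (K * U) * D := by field_simp

theorem finite_monic_irreducible_natDegree_le (F : Type*) [Field F] [Finite F] (n : ℕ) :
    {g : F[X] | g.Monic ∧ Irreducible g ∧ g.natDegree ≤ n}.Finite := by
  have : Finite (degreeLT F (n + 1)) := Finite.of_equiv _ (degreeLTEquiv F (n + 1)).symm.toEquiv
  refine (Set.toFinite (degreeLT F (n + 1) : Set F[X])).subset fun g hg => ?_
  rw [SetLike.mem_coe, mem_degreeLT]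
  exact (degree_le_natDegree).trans_lt (by exact_mod_cast Nat.lt_succ_of_le hg.2.2)

/-- The monic irreducible polynomials of degree at most `n`. -/
noncomputable def monicIrreducibles (F : Type*) [Field F] [Finite F] (n : ℕ) : Finset F[X] :=
  (finite_monic_irreducible_natDegree_le F n).toFinset

theorem mem_monicIrreducibles {n : ℕ} {g : F[X]} :
    g ∈ monicIrreducibles F n ↔ g.Monic ∧ Irreducible g ∧ g.natDegree ≤ n := by
  simp [monicIrreducibles]

theorem natDegree_le_sum_multiplicity {n : ℕ} {f : F[X]} (hf : f.Monic) (hn : f.natDegree ≤ n) :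
    f.natDegree ≤ ∑ g ∈ monicIrreducibles F n, g.natDegree * multiplicity g f := by
  classical
  have hdvd : f ∣ ∏ g ∈ monicIrreducibles F n, g ^ multiplicity g f := by
    have h₁ := UniqueFactorizationMonoid.prod_normalizedFactors hf.ne_zero
    refine h₁.symm.dvd.trans ?_
    rw [Finset.prod_multiset_count]
    have hsub : (UniqueFactorizationMonoid.normalizedFactors f).toFinset ⊆
        monicIrreducibles F n := by
      intro g hg
      rw [Multiset.mem_toFinset] at hg
      have hirr := UniqueFactorizationMonoid.irreducible_of_normalized_factor g hg
      rw [mem_monicIrreducibles]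
      refine ⟨?_, hirr, (natDegree_le_of_dvd
        (UniqueFactorizationMonoid.dvd_of_mem_normalizedFactors hg) hf.ne_zero).trans hn⟩
      rw [← UniqueFactorizationMonoid.normalize_normalized_factor g hg]
      exact monic_normalize hirr.ne_zero
    refine (Finset.prod_dvd_prod_of_dvd _ _ fun g hg => ?_).trans
      (Finset.prod_dvd_prod_of_subset _ _ _ hsub)
    rw [Multiset.mem_toFinset] at hg
    have hirr := UniqueFactorizationMonoid.irreducible_of_normalized_factor g hg
    have hfin : FiniteMultiplicity g f := FiniteMultiplicity.of_prime_left hirr.prime hf.ne_zero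
    refine pow_dvd_pow _ ?_
    refine hfin.le_multiplicity_of_pow_dvd ?_
    rw [← Multiset.prod_replicate]
    refine (Multiset.prod_dvd_prod_of_le (Multiset.le_count_iff_replicate_le.mp le_rfl)).trans ?_
    exact h₁.dvd
  have hmon : (∏ g ∈ monicIrreducibles F n, g ^ multiplicity g f).Monic :=
    monic_prod_of_monic _ _ fun g hg => (mem_monicIrreducibles.mp hg).1.pow _
  refine (natDegree_le_of_dvd hdvd hmon.ne_zero).trans ?_
  refine (natDegree_prod_le _ _).trans (Finset.sum_le_sum fun g _ => ?_)
  rw [natDegree_pow, mul_comm]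

/-- Distinct monic irreducibles of degree `d` are coprime and all divide `X^(q^d) - X`, so the
degree of their product is at most `q^d`. -/
theorem mul_card_monicIrreducibles_le (n d : ℕ) (hd : d ≠ 0) :
    d * ((monicIrreducibles F n).filter fun g => g.natDegree = d).card ≤ Nat.card F ^ d := by
  have hq1 : 1 < Nat.card F := Finite.one_lt_card
  have hne : (X ^ Nat.card F ^ d - X : F[X]) ≠ 0 :=
    FiniteField.X_pow_card_pow_sub_X_ne_zero F hd hq1
  have hdvd : (∏ g ∈ (monicIrreducibles F n).filter (fun g => g.natDegree = d), g) ∣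
      (X ^ Nat.card F ^ d - X : F[X]) := by
    refine Finset.prod_dvd_of_coprime ?_ ?_
    · intro g hg g' hg' hgg'
      have h := mem_monicIrreducibles.mp (Finset.mem_filter.mp hg).1
      have h' := mem_monicIrreducibles.mp (Finset.mem_filter.mp hg').1
      refine (h.2.1.coprime_iff_not_dvd).mpr fun hd' => hgg' ?_
      exact eq_of_monic_of_associated h.1 h'.1 (h.2.1.associated_of_dvd h'.2.1 hd')
    · intro g hg
      have h := mem_monicIrreducibles.mp (Finset.mem_filter.mp hg).1
      rw [← h.2.1.natDegree_dvd_iff_dvd_X_pow_card_pow_sub_X, (Finset.mem_filter.mp hg).2]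
  have := natDegree_le_of_dvd hdvd hne
  rw [FiniteField.X_pow_card_pow_sub_X_natDegree_eq F hd hq1, natDegree_prod_of_monic _ _
    (fun g hg => (mem_monicIrreducibles.mp (Finset.mem_filter.mp hg).1).1),
    Finset.sum_congr rfl (fun g hg => (Finset.mem_filter.mp hg).2), Finset.sum_const,
    smul_eq_mul] at this
  rwa [mul_comm]

/-- Double counting: `n` is at most the sum of `deg g * ν(g)` for each matrix, and the order of
summation is exchanged. -/
theorem mul_unc_le_sum (n : ℕ) :
    n * unc n F ≤ ∑ g ∈ monicIrreducibles F n, ∑ m ∈ Finset.Icc 1 (n / g.natDegree),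
      g.natDegree * m * Nat.card {φ : Module.End F (Fin n → F) //
        EndIsUncyclic φ ∧ multiplicity g φ.charpoly = m} := by
  classical
  have := Fintype.ofFinite (Module.End F (Fin n → F))
  let U : Finset (Module.End F (Fin n → F)) := Finset.univ.filter EndIsUncyclic
  have hU : unc n F = U.card := by
    rw [unc_eq, Nat.card_eq_fintype_card, Fintype.card_subtype]
  have hT : ∀ (g : F[X]) m, Nat.card {φ : Module.End F (Fin n → F) //
        EndIsUncyclic φ ∧ multiplicity g φ.charpoly = m} =
      (U.filter fun φ => multiplicity g φ.charpoly = m).card := by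
    intro g m
    rw [Nat.card_eq_fintype_card, Fintype.card_subtype, Finset.filter_filter]
  have h₁ : n * unc n F ≤ ∑ φ ∈ U, ∑ g ∈ monicIrreducibles F n,
      g.natDegree * multiplicity g φ.charpoly := by
    rw [hU, mul_comm, ← smul_eq_mul]
    refine Finset.card_nsmul_le_sum _ _ _ fun φ _ => ?_
    have hdeg : φ.charpoly.natDegree = n := by rw [LinearMap.charpoly_natDegree]; simp
    have := natDegree_le_sum_multiplicity φ.charpoly_monic hdeg.le
    rwa [hdeg] at this
  refine h₁.trans ?_
  rw [Finset.sum_comm]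
  refine Finset.sum_le_sum fun g hg => ?_
  obtain ⟨hmon, hirr, hgn⟩ := mem_monicIrreducibles.mp hg
  have hmaps : ∀ φ ∈ U, multiplicity g φ.charpoly ∈ Finset.range (n / g.natDegree + 1) := by
    intro φ _
    rw [Finset.mem_range, Nat.lt_succ_iff, Nat.le_div_iff_mul_le hirr.natDegree_pos]
    have := natDegree_le_of_dvd (pow_multiplicity_dvd g φ.charpoly) φ.charpoly_monic.ne_zero
    rw [natDegree_pow, LinearMap.charpoly_natDegree] at this
    simpa using this
  -- `sum_range_succ'` isolates the fibre `m = 0`, which contributes nothing.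
  rw [← Finset.sum_fiberwise_of_maps_to hmaps, Finset.sum_range_succ', ← Finset.sum_image
    (s := Finset.range (n / g.natDegree)) (g := fun i => i + 1)
    (f := fun m => ∑ φ ∈ U with multiplicity g φ.charpoly = m,
      g.natDegree * multiplicity g φ.charpoly) (by intro a _ b _ h; simpa using h)]
  have himg : (Finset.range (n / g.natDegree)).image (fun i => i + 1) =
      Finset.Icc 1 (n / g.natDegree) := by
    ext m
    simp only [Finset.mem_image, Finset.mem_range, Finset.mem_Icc]
    exact ⟨by rintro ⟨a, ha, rfl⟩; omega, fun h => ⟨m - 1, by omega, by omega⟩⟩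
  have hfib : ∀ m, ∑ φ ∈ U with multiplicity g φ.charpoly = m,
      g.natDegree * multiplicity g φ.charpoly = g.natDegree * m *
        (U.filter fun φ => multiplicity g φ.charpoly = m).card := by
    intro m
    rw [Finset.sum_congr rfl (fun φ hφ => by rw [(Finset.mem_filter.mp hφ).2]), Finset.sum_const,
      smul_eq_mul, mul_comm]
  rw [himg]
  simp only [hfib, hT]
  simp

theorem omega_le_one_sub_inv {Q : ℝ} (hQ : 1 < Q) {m : ℕ} (hm : m ≠ 0) :
    omega m Q ≤ 1 - Q⁻¹ := by
  obtain ⟨k, rfl⟩ : ∃ k, m = k + 1 := ⟨m - 1, by omega⟩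
  clear hm
  induction k with
  | zero => simp [omega]
  | succ k ih =>
    rw [omega_succ]
    refine (mul_le_of_le_one_right (omega_pos hQ _).le ?_).trans ih
    simp only [sub_le_self_iff]
    positivity

theorem noncyclicWeight_nonneg {Q : ℝ} (hQ : 1 < Q) {m : ℕ} (hm : m ≠ 0) :
    0 ≤ noncyclicWeight Q m :=
  sub_nonneg.mpr (inv_anti₀ (omega_pos hQ m) (omega_le_one_sub_inv hQ hm))

/-- The factor `d = deg g` is absorbed by the count of irreducibles, since `d` times their number is
at most `q^d`. -/
theorem mul_uncDensity_le (n : ℕ) :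
    n * uncDensity n F ≤ ∑ d ∈ Finset.Icc 1 n, (Nat.card F : ℝ) ^ d *
      ∑ m ∈ Finset.Icc 1 (n / d), m * noncyclicWeight ((Nat.card F : ℝ) ^ d) m *
        uncDensity (n - d * m) F := by
  have hq1 : 1 < Nat.card F := Finite.one_lt_card
  have hq1' : (1 : ℝ) < Nat.card F := by exact_mod_cast hq1
  have hGL : (0 : ℝ) < cardGL (Nat.card F) n := by exact_mod_cast cardGL_pos hq1 n
  set S : ℕ → ℝ := fun d => ∑ m ∈ Finset.Icc 1 (n / d),
    m * noncyclicWeight ((Nat.card F : ℝ) ^ d) m * uncDensity (n - d * m) F with hS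
  have hS0 : ∀ d ∈ Finset.Icc 1 n, 0 ≤ S d := by
    intro d hd
    refine Finset.sum_nonneg fun m hm => ?_
    have hm1 := (Finset.mem_Icc.mp hm).1
    have hd1 := (Finset.mem_Icc.mp hd).1
    exact mul_nonneg (mul_nonneg (Nat.cast_nonneg _) (noncyclicWeight_nonneg
      (one_lt_pow₀ hq1' (by omega)) (by omega))) (uncDensity_nonneg _ _)
  have h₁ : n * uncDensity n F ≤ ∑ g ∈ monicIrreducibles F n, g.natDegree * S g.natDegree := by
    have h := (Nat.cast_le (α := ℝ)).mpr (mul_unc_le_sum (F := F) n)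
    push_cast at h
    have hc : (0 : ℝ) ≤ (Nat.card F : ℝ) ^ n / cardGL (Nat.card F) n := by positivity
    calc n * uncDensity n F
        = (Nat.card F : ℝ) ^ n / cardGL (Nat.card F) n * (n * unc n F) := by
          rw [uncDensity]; ring
      _ ≤ _ := mul_le_mul_of_nonneg_left h hc
      _ ≤ _ := by
        rw [Finset.mul_sum]
        refine Finset.sum_le_sum fun g hg => ?_
        obtain ⟨hmon, hirr, hgn⟩ := mem_monicIrreducibles.mp hg
        rw [hS, Finset.mul_sum, Finset.mul_sum]
        refine Finset.sum_le_sum fun m hm => ?_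
        obtain ⟨hm1, hm2⟩ := Finset.mem_Icc.mp hm
        rw [Nat.le_div_iff_mul_le hirr.natDegree_pos, mul_comm] at hm2
        have := card_endIsUncyclic_multiplicity_density_le hmon hirr (by omega : m ≠ 0) hm2
        calc _ = (g.natDegree : ℝ) * m * ((Nat.card F : ℝ) ^ n *
              Nat.card {φ : Module.End F (Fin n → F) //
                EndIsUncyclic φ ∧ multiplicity g φ.charpoly = m} / cardGL (Nat.card F) n) := by
              ring
          _ ≤ _ := mul_le_mul_of_nonneg_left this (by positivity)
          _ = _ := by ring
  refine h₁.trans ?_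
  have hmaps : ∀ g ∈ monicIrreducibles F n, g.natDegree ∈ Finset.Icc 1 n := by
    intro g hg
    obtain ⟨hmon, hirr, hgn⟩ := mem_monicIrreducibles.mp hg
    exact Finset.mem_Icc.mpr ⟨hirr.natDegree_pos, hgn⟩
  rw [← Finset.sum_fiberwise_of_maps_to hmaps]
  refine Finset.sum_le_sum fun d hd => ?_
  rw [Finset.sum_congr rfl (fun g hg => by rw [(Finset.mem_filter.mp hg).2]), Finset.sum_const,
    nsmul_eq_mul, ← mul_assoc]
  refine mul_le_mul_of_nonneg_right ?_ (hS0 d hd)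
  have := mul_card_monicIrreducibles_le (F := F) n d (by have := (Finset.mem_Icc.mp hd).1; omega)
  rw [mul_comm]
  exact_mod_cast this

end Recursion

/-! ### From the recursion to exponential growth -/

section Analysis

/-- An instance of Chebyshev's sum inequality: the weights `N + 1 - s` decrease with mean `(N +
3)/2` while `r^s` increases with sum `(r^N - 1)/(r - 1)`. In the induction the gap between the two
sides grows by exactly the quantity shown nonnegative in `hconv`. -/
theorem sum_sub_mul_pow_le {r : ℝ} (hr : 1 ≤ r) (N : ℕ) :
    2 * (r - 1) * ∑ s ∈ Finset.range N, ((N : ℝ) + 1 - s) * r ^ s ≤ (N + 3) * (r ^ N - 1) := by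
  have hconv : ∀ N : ℕ, 0 ≤ N * r ^ (N + 1) - (N + 1) * r ^ N + 1 := by
    intro N
    induction N with
    | zero => simp
    | succ N ih =>
      have : 0 ≤ (N + 1) * r ^ N * (r - 1) ^ 2 := by positivity
      push_cast
      rw [pow_succ r (N + 1), pow_succ r N] at *
      nlinarith
  induction N with
  | zero => simp
  | succ N ih =>
    have hgeom : (r - 1) * ∑ s ∈ Finset.range N, r ^ s = r ^ N - 1 := mul_geom_sum r N
    have hsplit : ∑ s ∈ Finset.range (N + 1), (((N + 1 : ℕ) : ℝ) + 1 - s) * r ^ s =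
        ∑ s ∈ Finset.range N, ((N : ℝ) + 1 - s) * r ^ s + ∑ s ∈ Finset.range N, r ^ s +
          2 * r ^ N := by
      rw [Finset.sum_range_succ, ← Finset.sum_add_distrib]
      congr 1
      · refine Finset.sum_congr rfl fun s _ => ?_
        push_cast
        ring
      · push_cast
        ring
    rw [hsplit, mul_add, mul_add]
    have := hconv N
    have h2 : 2 * (r - 1) * ∑ s ∈ Finset.range N, r ^ s = 2 * (r ^ N - 1) := by
      rw [mul_assoc, hgeom]
    rw [h2]
    push_cast
    rw [pow_succ] at *
    nlinarith

/-- The growth of a nonnegative sequence with `n pₙ ≤ ℓ ∑ⱼ j pₙ₋ⱼ`, the sum over `2 ≤ j ≤ n`. -/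
theorem le_mul_pow_of_recursion {p : ℕ → ℝ} {l r : ℝ} (hl : 0 ≤ l) (hr : 1 < r)
    (hlr : l ≤ 2 * (r - 1)) (h0 : p 0 = 1)
    (hp : ∀ n : ℕ, 1 ≤ n → n * p n ≤ l * ∑ j ∈ Finset.Icc 2 n, (j : ℝ) * p (n - j)) (n : ℕ) :
    p (n + 2) ≤ l * r ^ n := by
  -- For `n = 1` the sum over `2 ≤ j ≤ 1` is empty.
  have h1 : p 1 ≤ 0 := by simpa using hp 1 le_rfl
  induction n using Nat.strong_induction_on with
  | _ n ih =>
  have hsum : ∑ j ∈ Finset.Icc 2 (n + 2), (j : ℝ) * p (n + 2 - j) =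
      ∑ i ∈ Finset.range (n + 1), ((n : ℝ) + 2 - i) * p i := by
    rw [show Finset.Icc 2 (n + 2) = Finset.Ico 2 (n + 3) from rfl, Finset.sum_Ico_eq_sum_range,
      show n + 3 - 2 = n + 1 by omega, ← Finset.sum_range_reflect]
    refine Finset.sum_congr rfl fun i hi => ?_
    have := Finset.mem_range.mp hi
    rw [show n + 2 - (2 + (n + 1 - 1 - i)) = i by omega,
      show 2 + (n + 1 - 1 - i) = n + 2 - i by omega, Nat.cast_sub (by omega)]
    push_cast
    ring
  have h := hp (n + 2) (by omega)
  rw [hsum] at h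
  have hn2 : (0 : ℝ) < (n : ℝ) + 2 := by positivity
  suffices hs : ∑ i ∈ Finset.range (n + 1), ((n : ℝ) + 2 - i) * p i ≤ (n + 2) * r ^ n by
    refine le_of_mul_le_mul_left ?_ hn2
    push_cast at h
    calc ((n : ℝ) + 2) * p (n + 2) ≤ _ := h
      _ ≤ l * ((n + 2) * r ^ n) := by gcongr
      _ = _ := by ring
  rcases n with _ | N
  · simp [h0]
  -- The terms with `p 0 = 1` and `p 1 ≤ 0` are separated. The others contribute at most `(N +
  -- 3)(r^N - 1)`, and the `p 0` term, of weight `N + 3`, exactly restores the subtracted `N + 3`.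
  rw [Finset.sum_range_succ', Finset.sum_range_succ', h0]
  have hle : ∑ s ∈ Finset.range N, (((N + 1 : ℕ) : ℝ) + 2 - ((s + 1 + 1 : ℕ) : ℝ)) *
      p (s + 1 + 1) ≤ l * ∑ s ∈ Finset.range N, ((N : ℝ) + 1 - s) * r ^ s := by
    rw [Finset.mul_sum]
    refine Finset.sum_le_sum fun s hs => ?_
    have hsN := Finset.mem_range.mp hs
    have hsN' : (s : ℝ) < N := by exact_mod_cast hsN
    have := ih s (by omega)
    push_cast
    have hc : 0 ≤ (N : ℝ) + 1 - s := by linarith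
    calc ((N : ℝ) + 1 + 2 - (s + 1 + 1)) * p (s + 1 + 1)
        = ((N : ℝ) + 1 - s) * p (s + 2) := by ring_nf
      _ ≤ ((N : ℝ) + 1 - s) * (l * r ^ s) := by gcongr
      _ = _ := by ring
  have hS0 : 0 ≤ ∑ s ∈ Finset.range N, ((N : ℝ) + 1 - s) * r ^ s := by
    refine Finset.sum_nonneg fun s hs => ?_
    have hsN' : (s : ℝ) < N := by exact_mod_cast Finset.mem_range.mp hs
    have hc : 0 ≤ (N : ℝ) + 1 - s := by linarith
    positivity
  have hcheb := sum_sub_mul_pow_le hr.le N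
  have hle2 : l * ∑ s ∈ Finset.range N, ((N : ℝ) + 1 - s) * r ^ s ≤ (N + 3) * (r ^ N - 1) :=
    (mul_le_mul_of_nonneg_right hlr hS0).trans hcheb
  have hlast : (((N + 1 : ℕ) : ℝ) + 2 - ((0 + 1 : ℕ) : ℝ)) * p (0 + 1) ≤ 0 := by
    refine mul_nonpos_of_nonneg_of_nonpos ?_ h1
    push_cast
    linarith [(Nat.cast_nonneg N : (0 : ℝ) ≤ N)]
  have hrN : r ^ N ≤ r ^ (N + 1) := pow_le_pow_right₀ hr.le (Nat.le_succ N)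
  have hfin : ((N : ℝ) + 3) * r ^ N ≤ (N + 3) * r ^ (N + 1) := by gcongr
  push_cast at *
  nlinarith

/-- A bound for `noncyclicWeight` that does not depend on `m`. -/
noncomputable def weightBound (Q : ℝ) : ℝ := Q / ((Q - 1) * (Q ^ 2 - Q - 1))

/-- The inequality `∏ (1 - x_i) ≥ 1 - ∑ x_i`, used from the second factor on; the geometric partial
sum is kept in closed form so that the induction closes. -/
theorem le_omega_succ {Q : ℝ} (hQ : 1 < Q) (m : ℕ) :
    (1 - Q⁻¹) * (1 - (Q * (Q - 1))⁻¹ * (1 - (Q ^ m)⁻¹)) ≤ omega (m + 1) Q := by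
  induction m with
  | zero => simp [omega]
  | succ m ih =>
    rw [omega_succ]
    have hQ0 : 0 < Q := by linarith
    have hQ1 : 0 < Q - 1 := by linarith
    have h1 : 0 < 1 - Q⁻¹ := by rw [sub_pos]; exact inv_lt_one_of_one_lt₀ hQ
    have h2 : 0 < 1 - (Q ^ (m + 1 + 1))⁻¹ := by
      rw [sub_pos]; exact inv_lt_one_of_one_lt₀ (one_lt_pow₀ hQ (by omega))
    refine le_trans ?_ (mul_le_mul_of_nonneg_right ih h2.le)
    rw [mul_assoc]
    refine mul_le_mul_of_nonneg_left ?_ h1.le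
    have h3 : (Q * (Q - 1))⁻¹ * (1 - (Q ^ (m + 1))⁻¹) =
        (Q * (Q - 1))⁻¹ * (1 - (Q ^ m)⁻¹) + (Q ^ (m + 1 + 1))⁻¹ := by
      rw [pow_succ, pow_succ]
      field_simp
      ring
    have h4 : 0 ≤ (Q * (Q - 1))⁻¹ * (1 - (Q ^ m)⁻¹) := by
      refine mul_nonneg (by positivity) (sub_nonneg.mpr (inv_le_one_of_one_le₀ (one_le_pow₀ hQ.le)))
    have h5 : 0 ≤ (Q ^ (m + 1 + 1))⁻¹ := by positivity
    rw [h3]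
    nlinarith

theorem noncyclicWeight_le {Q : ℝ} (hQ : 3 ≤ Q) {m : ℕ} (hm : m ≠ 0) :
    noncyclicWeight Q m ≤ weightBound Q := by
  obtain ⟨k, rfl⟩ : ∃ k, m = k + 1 := ⟨m - 1, by omega⟩
  have hQ0 : 0 < Q := by linarith
  have hQ1 : 0 < Q - 1 := by linarith
  have h := le_omega_succ (by linarith : 1 < Q) k
  have hden : 0 < Q ^ 2 - Q - 1 := by nlinarith
  have h1 : (1 - Q⁻¹) * (1 - (Q * (Q - 1))⁻¹) ≤ omega (k + 1) Q := by
    refine le_trans ?_ h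
    have : 0 < 1 - Q⁻¹ := by rw [sub_pos]; exact inv_lt_one_of_one_lt₀ (by linarith)
    have : 0 ≤ (Q ^ k)⁻¹ := by positivity
    gcongr
    refine mul_le_of_le_one_right (by positivity) (by linarith)
  -- So `1/ω ≤ Q²/(Q² - Q - 1)`; subtracting `Q/(Q - 1)` leaves exactly `weightBound Q`.
  have h2 : (1 - Q⁻¹) * (1 - (Q * (Q - 1))⁻¹) = (Q ^ 2 - Q - 1) / Q ^ 2 := by
    field_simp
  rw [h2] at h1
  have h3 : (omega (k + 1) Q)⁻¹ ≤ ((Q ^ 2 - Q - 1) / Q ^ 2)⁻¹ := inv_anti₀ (by positivity) h1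
  have h4 : (1 - Q⁻¹)⁻¹ = Q / (Q - 1) := by
    rw [show 1 - Q⁻¹ = (Q - 1) / Q by field_simp, inv_div]
  rw [noncyclicWeight, weightBound, h4]
  refine (sub_le_sub_right h3 _).trans (le_of_eq ?_)
  rw [inv_div, div_sub_div _ _ hden.ne' hQ1.ne', div_eq_div_iff (mul_pos hden hQ1).ne'
    (mul_pos hQ1 hden).ne']
  ring

theorem noncyclicWeight_one (Q : ℝ) : noncyclicWeight Q 1 = 0 := by
  simp [noncyclicWeight, omega]

theorem weightBound_nonneg {Q : ℝ} (hQ : 3 ≤ Q) : 0 ≤ weightBound Q := by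
  have : 0 < Q - 1 := by linarith
  have : 0 < Q ^ 2 - Q - 1 := by nlinarith
  unfold weightBound
  positivity

/-- Needed for `Q = q^d` with `d ≥ 2`, hence the threshold `9 = 3²`; at `Q = 9` the ratio `Q²
weightBound Q` is `729/568`, just below `1.3`. -/
theorem weightBound_le {Q : ℝ} (hQ : 9 ≤ Q) : weightBound Q ≤ 1.3 / Q ^ 2 := by
  have h1 : 0 < Q - 1 := by linarith
  have h2 : 0 < Q ^ 2 - Q - 1 := by nlinarith
  rw [weightBound, div_le_div_iff₀ (by positivity) (by positivity)]
  nlinarith [mul_nonneg (sub_nonneg.mpr hQ) (sub_nonneg.mpr hQ),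
    mul_nonneg (sub_nonneg.mpr hQ) (sq_nonneg Q)]

/-- A bound for `∑_d q^d weightBound(q^d) / d`. -/
noncomputable def recursionBound (q : ℝ) : ℝ := q * weightBound q + 0.65 / (q * (q - 1))

theorem sum_pow_mul_weightBound_le {q : ℝ} (hq : 3 ≤ q) (n : ℕ) :
    ∑ d ∈ Finset.Icc 1 n, q ^ d * weightBound (q ^ d) / d ≤ recursionBound q := by
  have hq0 : 0 < q := by linarith
  have hq1 : 0 < q - 1 := by linarith
  -- The term `d = 1` is kept exactly. For `d ≥ 2`, `1/d ≤ 1/2` turns `1.3` into `0.65`, leaving a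
  -- geometric series whose exact partial sums carry the induction.
  suffices h : ∀ n : ℕ, ∑ d ∈ Finset.Icc 1 (n + 1), q ^ d * weightBound (q ^ d) / d ≤
      q * weightBound q + 0.65 / (q * (q - 1)) * (1 - (q ^ n)⁻¹) by
    have hmono : ∑ d ∈ Finset.Icc 1 n, q ^ d * weightBound (q ^ d) / d ≤
        ∑ d ∈ Finset.Icc 1 (n + 1), q ^ d * weightBound (q ^ d) / d := by
      refine Finset.sum_le_sum_of_subset_of_nonneg
        (Finset.Icc_subset_Icc le_rfl (Nat.le_succ n)) fun d hd _ => ?_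
      have hd1 := (Finset.mem_Icc.mp hd).1
      have : 3 ≤ q ^ d := hq.trans (le_self_pow₀ (by linarith) (by omega))
      have := weightBound_nonneg this
      positivity
    refine hmono.trans ((h n).trans ?_)
    rw [recursionBound]
    gcongr
    refine mul_le_of_le_one_right (by positivity) ?_
    simp only [sub_le_self_iff]
    positivity
  intro n
  induction n with
  | zero => simp
  | succ n ih =>
    rw [Finset.sum_Icc_succ_top (by omega)]
    have h9 : 9 ≤ q ^ (n + 1 + 1) := by
      have h1 : q ^ 2 ≤ q ^ (n + 1 + 1) := pow_le_pow_right₀ (by linarith) (by omega)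
      nlinarith
    have hQ0 : 0 < q ^ (n + 1 + 1) := by positivity
    have hterm : q ^ (n + 1 + 1) * weightBound (q ^ (n + 1 + 1)) / ((n + 1 + 1 : ℕ) : ℝ) ≤
        0.65 * (q ^ (n + 1 + 1))⁻¹ := by
      have h2 : (2 : ℝ) ≤ ((n + 1 + 1 : ℕ) : ℝ) := by
        push_cast; linarith [(Nat.cast_nonneg n : (0 : ℝ) ≤ n)]
      have hw := weightBound_le h9
      have hw0 := weightBound_nonneg (by linarith : (3 : ℝ) ≤ q ^ (n + 1 + 1))
      calc q ^ (n + 1 + 1) * weightBound (q ^ (n + 1 + 1)) / ((n + 1 + 1 : ℕ) : ℝ)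
          ≤ q ^ (n + 1 + 1) * (1.3 / (q ^ (n + 1 + 1)) ^ 2) / 2 := by gcongr
        _ = 0.65 * (q ^ (n + 1 + 1))⁻¹ := by field_simp; norm_num
    have hgeom : 0.65 / (q * (q - 1)) * (1 - (q ^ (n + 1))⁻¹) =
        0.65 / (q * (q - 1)) * (1 - (q ^ n)⁻¹) + 0.65 * (q ^ (n + 1 + 1))⁻¹ := by
      rw [pow_succ, pow_succ]
      field_simp
      ring
    rw [hgeom]
    linarith

variable {F : Type*} [Field F] [Finite F]

/-- The terms `m = 1` vanish, so only `j = d m ≥ 2` occurs. Writing `m = j / d` and enlarging the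
multiples of `d` to all `j` in the range makes the inner sum independent of `d`. -/
theorem mul_uncDensity_le_recursionBound (hq : 3 ≤ Nat.card F) (n : ℕ) :
    n * uncDensity n F ≤
      recursionBound (Nat.card F) * ∑ j ∈ Finset.Icc 2 n, (j : ℝ) * uncDensity (n - j) F := by
  have hq' : (3 : ℝ) ≤ Nat.card F := by exact_mod_cast hq
  refine (mul_uncDensity_le n).trans ?_
  have hS0 : 0 ≤ ∑ j ∈ Finset.Icc 2 n, (j : ℝ) * uncDensity (n - j) F :=
    Finset.sum_nonneg fun j _ => mul_nonneg (Nat.cast_nonneg _) (uncDensity_nonneg _ _)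
  refine le_trans ?_ (mul_le_mul_of_nonneg_right (sum_pow_mul_weightBound_le hq' n) hS0)
  rw [Finset.sum_mul]
  refine Finset.sum_le_sum fun d hd => ?_
  obtain ⟨hd1, hdn⟩ := Finset.mem_Icc.mp hd
  have hd0 : (0 : ℝ) < d := by exact_mod_cast hd1
  have hQ : (3 : ℝ) ≤ (Nat.card F : ℝ) ^ d := hq'.trans (le_self_pow₀ (by linarith) (by omega))
  have hw := weightBound_nonneg hQ
  have hinner : ∑ m ∈ Finset.Icc 1 (n / d), m * noncyclicWeight ((Nat.card F : ℝ) ^ d) m *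
      uncDensity (n - d * m) F ≤ weightBound ((Nat.card F : ℝ) ^ d) / d *
        ∑ j ∈ Finset.Icc 2 n, (j : ℝ) * uncDensity (n - j) F := by
    have hstep : ∑ m ∈ Finset.Icc 1 (n / d), m * noncyclicWeight ((Nat.card F : ℝ) ^ d) m *
        uncDensity (n - d * m) F ≤ ∑ m ∈ Finset.Icc 2 (n / d),
          weightBound ((Nat.card F : ℝ) ^ d) / d *
            (((d * m : ℕ) : ℝ) * uncDensity (n - d * m) F) := by
      have hsub : Finset.Icc 2 (n / d) ⊆ Finset.Icc 1 (n / d) :=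
        Finset.Icc_subset_Icc (by omega) le_rfl
      rw [← Finset.sum_subset hsub]
      · refine Finset.sum_le_sum fun m hm => ?_
        have hm2 := (Finset.mem_Icc.mp hm).1
        have h1 := noncyclicWeight_le hQ (m := m) (by omega)
        have h2 := uncDensity_nonneg (n - d * m) F
        calc m * noncyclicWeight ((Nat.card F : ℝ) ^ d) m * uncDensity (n - d * m) F
            ≤ m * weightBound ((Nat.card F : ℝ) ^ d) * uncDensity (n - d * m) F := by gcongr
          _ = _ := by push_cast; field_simp
      · intro m hm hm'
        have : m = 1 := by
          simp only [Finset.mem_Icc] at hm hm'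
          omega
        rw [this, noncyclicWeight_one]
        simp
    refine hstep.trans ?_
    rw [← Finset.mul_sum]
    refine mul_le_mul_of_nonneg_left ?_ (by positivity)
    rw [← Finset.sum_image (s := Finset.Icc 2 (n / d)) (g := fun m : ℕ => d * m)
      (f := fun j : ℕ => (j : ℝ) * uncDensity (n - j) F)
      (by intro a _ b _ h; exact Nat.eq_of_mul_eq_mul_left hd1 h)]
    refine Finset.sum_le_sum_of_subset_of_nonneg ?_ fun j _ _ =>
      mul_nonneg (Nat.cast_nonneg _) (uncDensity_nonneg _ _)
    intro j hj
    obtain ⟨m, hm, rfl⟩ := Finset.mem_image.mp hj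
    obtain ⟨hm2, hm3⟩ := Finset.mem_Icc.mp hm
    rw [Nat.le_div_iff_mul_le hd1, mul_comm] at hm3
    exact Finset.mem_Icc.mpr ⟨by nlinarith, hm3⟩
  calc _ ≤ (Nat.card F : ℝ) ^ d * (weightBound ((Nat.card F : ℝ) ^ d) / d *
        ∑ j ∈ Finset.Icc 2 n, (j : ℝ) * uncDensity (n - j) F) := by gcongr
    _ = _ := by ring

/-- The bound for the number of uncyclic matrices in terms of any admissible growth rate `r`. -/
theorem unc_lt_of_recursionBound (hq : 3 ≤ Nat.card F) {r c : ℝ} (hr : 1 < r)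
    (hlr : recursionBound (Nat.card F) ≤ 2 * (r - 1))
    (hc : (Nat.card F : ℝ) * omega 2 (Nat.card F) * recursionBound (Nat.card F) < c * r ^ 2)
    {n : ℕ} (hn : 1 ≤ n) :
    (unc n F : ℝ) < c * (Nat.card F : ℝ) ^ ((n : ℤ) ^ 2 - n - 1) * r ^ n := by
  have hq1 : 1 < Nat.card F := by omega
  have hq' : (3 : ℝ) ≤ Nat.card F := by exact_mod_cast hq
  have hq0 : (0 : ℝ) < Nat.card F := by linarith
  have hGL : (0 : ℝ) < cardGL (Nat.card F) n := by exact_mod_cast cardGL_pos hq1 n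
  have hl : 0 ≤ recursionBound (Nat.card F) := by
    have := weightBound_nonneg hq'
    have : (0 : ℝ) < Nat.card F - 1 := by linarith
    unfold recursionBound
    positivity
  have hω0 : ∀ m, 0 < omega m (Nat.card F) := omega_pos (by linarith)
  have hc0 : 0 < c := by
    have h : 0 < c * r ^ 2 := lt_of_le_of_lt (mul_nonneg (mul_nonneg hq0.le (hω0 2).le) hl) hc
    exact (pos_iff_pos_of_mul_pos h).mpr (by positivity)
  have hbound := le_mul_pow_of_recursion (p := fun n => uncDensity n F) hl hr hlr uncDensity_zero
    (fun n _ => mul_uncDensity_le_recursionBound hq n)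
  -- An exact identity, from `|GL(n, q)| = q^(n²) ω(n, q)`. Below, `ω(n, q)` is replaced by `ω(2,
  -- q)` for `n ≥ 2`, while for `n = 1` the density is zero.
  have hunc : (unc n F : ℝ) = (Nat.card F : ℝ) ^ ((n : ℤ) ^ 2 - n - 1) *
      (Nat.card F * omega n (Nat.card F) * uncDensity n F) := by
    have hpow : (Nat.card F : ℝ) ^ ((n : ℤ) ^ 2 - n - 1) =
        (Nat.card F : ℝ) ^ n ^ 2 / (Nat.card F : ℝ) ^ n / Nat.card F := by
      rw [zpow_sub₀ hq0.ne', zpow_sub₀ hq0.ne', zpow_one]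
      norm_cast
    have := (hω0 n).ne'
    rw [hpow, uncDensity, cardGL_eq hq1]
    field_simp
  rw [hunc, mul_comm c, mul_assoc _ c]
  refine mul_lt_mul_of_pos_left ?_ (zpow_pos hq0 _)
  rcases Nat.lt_or_ge n 2 with h2 | h2
  · have hn1 : n = 1 := by omega
    subst hn1
    have h := mul_uncDensity_le_recursionBound hq 1
    have h1 : uncDensity 1 F ≤ 0 := by simpa using h
    have : Nat.card F * omega 1 (Nat.card F) * uncDensity 1 F ≤ 0 :=
      mul_nonpos_of_nonneg_of_nonpos (mul_nonneg hq0.le (hω0 1).le) h1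
    refine this.trans_lt ?_
    positivity
  · obtain ⟨k, rfl⟩ : ∃ k, n = k + 2 := ⟨n - 2, by omega⟩
    have hω : ∀ k, omega (k + 2) (Nat.card F) ≤ omega 2 (Nat.card F) := by
      intro k
      induction k with
      | zero => rfl
      | succ k ih =>
        rw [show k + 1 + 2 = (k + 2) + 1 by ring, omega_succ]
        refine (mul_le_of_le_one_right (hω0 _).le ?_).trans ih
        simp only [sub_le_self_iff]
        positivity
    have hd := uncDensity_nonneg (k + 2) F
    calc Nat.card F * omega (k + 2) (Nat.card F) * uncDensity (k + 2) F
        ≤ Nat.card F * omega 2 (Nat.card F) * (recursionBound (Nat.card F) * r ^ k) := by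
          have := hω k
          have := hbound k
          have := (hω0 2).le
          gcongr
      _ = Nat.card F * omega 2 (Nat.card F) * recursionBound (Nat.card F) * r ^ k := by ring
      _ < c * r ^ 2 * r ^ k := by gcongr
      _ = c * r ^ (k + 2) := by ring

end Analysis

/-! ### Bounds for the constant `c*(q)` -/

section Constant

theorem multipliable_one_sub_inv_pow {q : ℝ} (hq : 1 < q) (k : ℕ) :
    Multipliable fun i : ℕ => 1 - (q ^ (i + k))⁻¹ := by
  have hs : Summable fun i : ℕ => -(q ^ (i + k))⁻¹ := by
    have h := (summable_geometric_of_lt_one (by positivity) (inv_lt_one_of_one_lt₀ hq)).mul_right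
      (q⁻¹ ^ k)
    refine (h.congr fun i => ?_).neg
    rw [← pow_add, inv_pow]
  exact (Real.multipliable_one_add_of_summable hs).congr fun i => by ring

theorem one_sub_inv_pow_nonneg {q : ℝ} (hq : 1 < q) (k : ℕ) : 0 ≤ 1 - (q ^ k)⁻¹ :=
  sub_nonneg.mpr (inv_le_one_of_one_le₀ (one_le_pow₀ hq.le))

theorem tprod_one_sub_inv_pow_le_one {q : ℝ} (hq : 1 < q) (k : ℕ) :
    ∏' i : ℕ, (1 - (q ^ (i + k))⁻¹) ≤ 1 := by
  refine le_of_tendsto' (multipliable_one_sub_inv_pow hq k).hasProd.tendsto_prod_nat fun N => ?_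
  refine Finset.prod_le_one (fun i _ => one_sub_inv_pow_nonneg hq _) fun i _ => ?_
  simp only [sub_le_self_iff]
  positivity

/-- Again `∏ (1 - x_i) ≥ 1 - ∑ x_i`, for finite products with the geometric sum in closed form,
followed by passage to the limit. -/
theorem le_tprod_one_sub_inv_pow {q : ℝ} (hq : 1 < q) (k : ℕ) :
    1 - (q ^ k * (q - 1))⁻¹ ≤ ∏' i : ℕ, (1 - (q ^ (i + (k + 1)))⁻¹) := by
  have hq1 : 0 < q - 1 := by linarith
  have hq0 : 0 < q := by linarith
  refine ge_of_tendsto' (multipliable_one_sub_inv_pow hq (k + 1)).hasProd.tendsto_prod_nat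
    fun N => ?_
  have h : 1 - (q ^ k * (q - 1))⁻¹ * (1 - (q ^ N)⁻¹) ≤
      ∏ i ∈ Finset.range N, (1 - (q ^ (i + (k + 1)))⁻¹) := by
    induction N with
    | zero => simp
    | succ N ih =>
      rw [Finset.prod_range_succ]
      refine le_trans ?_ (mul_le_mul_of_nonneg_right ih (one_sub_inv_pow_nonneg hq _))
      have h1 : (q ^ k * (q - 1))⁻¹ * (1 - (q ^ (N + 1))⁻¹) =
          (q ^ k * (q - 1))⁻¹ * (1 - (q ^ N)⁻¹) + (q ^ (N + (k + 1)))⁻¹ := by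
        rw [pow_succ, pow_add, pow_succ]
        field_simp
        ring
      have h2 : 0 ≤ (q ^ k * (q - 1))⁻¹ * (1 - (q ^ N)⁻¹) :=
        mul_nonneg (by positivity) (one_sub_inv_pow_nonneg hq _)
      have h3 : 0 ≤ (q ^ (N + (k + 1)))⁻¹ := by positivity
      rw [h1]
      nlinarith
  refine le_trans ?_ h
  have : 0 ≤ (q ^ N)⁻¹ := by positivity
  have : (q ^ k * (q - 1))⁻¹ * (1 - (q ^ N)⁻¹) ≤ (q ^ k * (q - 1))⁻¹ :=
    mul_le_of_le_one_right (by positivity) (by linarith)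
  linarith

theorem tprod_one_sub_inv_pow_eq_mul {q : ℝ} (hq : 1 < q) (k : ℕ) :
    ∏' i : ℕ, (1 - (q ^ (i + k))⁻¹) =
      (1 - (q ^ k)⁻¹) * ∏' i : ℕ, (1 - (q ^ (i + (k + 1)))⁻¹) := by
  have h : Multipliable fun i : ℕ => 1 - (q ^ (i + 1 + k))⁻¹ :=
    (multipliable_one_sub_inv_pow hq (k + 1)).congr fun i => by rw [add_assoc, add_comm 1 k]
  have h2 := tprod_eq_zero_mul' (f := fun i : ℕ => 1 - (q ^ (i + k))⁻¹) h
  simp only [zero_add, add_assoc, add_comm 1 k] at h2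
  exact h2

theorem cZeroInf_le {q : ℝ} (hq : 1 < q) : cZeroInf q ≤ q / (q - 1) := by
  have hq1 : 0 < q - 1 := by linarith
  have hq0 : 0 < q := by linarith
  have h := le_tprod_one_sub_inv_pow hq 1
  rw [pow_one] at h
  calc cZeroInf q ≤ q ^ 2 * (q * (q - 1))⁻¹ := by
        rw [cZeroInf]
        gcongr
        linarith
    _ = q / (q - 1) := by field_simp

theorem one_lt_cZeroInf {q : ℝ} (hq : 1 < q) : 1 < cZeroInf q := by
  have hq0 : 0 < q := by linarith
  have h2 : 0 < 1 - (q ^ 2)⁻¹ := by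
    rw [sub_pos]; exact inv_lt_one_of_one_lt₀ (one_lt_pow₀ hq (by omega))
  have h3 : 1 - (q ^ 3)⁻¹ < 1 := by simp only [sub_lt_self_iff]; positivity
  have h : ∏' i : ℕ, (1 - (q ^ (i + 2))⁻¹) < 1 - (q ^ 2)⁻¹ := by
    rw [tprod_one_sub_inv_pow_eq_mul hq 2, tprod_one_sub_inv_pow_eq_mul hq 3]
    refine mul_lt_of_lt_one_right h2 (lt_of_le_of_lt ?_ h3)
    exact mul_le_of_le_one_right (one_sub_inv_pow_nonneg hq 3)
      (tprod_one_sub_inv_pow_le_one hq _)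
  calc 1 = q ^ 2 * (q ^ 2)⁻¹ := by field_simp
    _ < cZeroInf q := by
      rw [cZeroInf]
      gcongr
      linarith

theorem le_omegaInf {q : ℝ} (hq : 1 < q) : 1 - (q - 1)⁻¹ ≤ omegaInf q := by
  simpa [omegaInf] using le_tprod_one_sub_inv_pow hq 0

/-- Bernoulli's inequality `(1 - q⁻²)^q ≥ 1 - q⁻¹`, after taking logarithms. -/
theorem log_combination_nonneg {q : ℕ} (hq : 2 ≤ q) :
    0 ≤ (q : ℝ) * Real.log (1 - ((q : ℝ) ^ 2)⁻¹) - Real.log (1 - (q : ℝ)⁻¹) := by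
  have hq' : (1 : ℝ) < q := by exact_mod_cast hq
  have hx : 0 < 1 - (q : ℝ)⁻¹ := by rw [sub_pos]; exact inv_lt_one_of_one_lt₀ hq'
  have hx2 : ((q : ℝ) ^ 2)⁻¹ ≤ 1 := inv_le_one_of_one_le₀ (one_le_pow₀ hq'.le)
  rw [sub_nonneg, ← Real.log_pow]
  refine Real.log_le_log hx ?_
  have h := one_add_mul_le_pow (a := -((q : ℝ) ^ 2)⁻¹) (by linarith) q
  have h2 : (1 : ℝ) + q * -((q : ℝ) ^ 2)⁻¹ = 1 - (q : ℝ)⁻¹ := by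
    field_simp
    ring
  rw [h2] at h
  simpa [sub_eq_add_neg] using h

/-- With `x = 1/q`, the bounds `log (1 - x²) ≤ -x²` and `-log (1 - x) ≤ x + x²/2 + x³/(1 - x)` are
combined; the linear terms cancel. -/
theorem log_combination_le {q : ℝ} (hq : 1 < q) :
    q * Real.log (1 - (q ^ 2)⁻¹) - Real.log (1 - q⁻¹) ≤
      q⁻¹ ^ 2 / 2 + q⁻¹ ^ 3 / (1 - q⁻¹) := by
  have hq0 : 0 < q := by linarith
  have hx1 : q⁻¹ < 1 := inv_lt_one_of_one_lt₀ hq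
  have hx0 : 0 < q⁻¹ := by positivity
  have h1 : Real.log (1 - (q ^ 2)⁻¹) ≤ -(q ^ 2)⁻¹ := by
    have h : 0 < 1 - (q ^ 2)⁻¹ := by
      rw [sub_pos]; exact inv_lt_one_of_one_lt₀ (one_lt_pow₀ hq (by omega))
    linarith [Real.log_le_sub_one_of_pos h]
  have h2 := Real.abs_log_sub_add_sum_range_le (x := q⁻¹) (by rwa [abs_of_pos hx0]) 2
  rw [abs_of_pos hx0, Finset.sum_range_succ, Finset.sum_range_one] at h2
  have h3 := (abs_le.mp h2).1
  have h4 : q * Real.log (1 - (q ^ 2)⁻¹) ≤ -q⁻¹ := by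
    calc _ ≤ q * -(q ^ 2)⁻¹ := by gcongr
      _ = -q⁻¹ := by field_simp
  norm_num at h3 h4 ⊢
  linarith

theorem one_lt_cStar {q : ℕ} (hq : 3 ≤ q) : 1 < cStar q := by
  have hq' : (3 : ℝ) ≤ q := by exact_mod_cast hq
  have hQ : (9 : ℝ) ≤ (q : ℝ) ^ 2 := by nlinarith
  have h1 := one_lt_cZeroInf (by linarith : (1 : ℝ) < q)
  have h2 := one_lt_cZeroInf (by linarith : (1 : ℝ) < (q : ℝ) ^ 2)
  have h3 := omega_pos (by linarith : (1 : ℝ) < q) 4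
  have h4 : 0 < omegaInf ((q : ℝ) ^ 2) := by
    refine lt_of_lt_of_le ?_ (le_omegaInf (by linarith))
    rw [sub_pos]
    exact inv_lt_one_of_one_lt₀ (by linarith)
  have h5 := log_combination_nonneg (by omega : 2 ≤ q)
  have h6 : 0 ≤ (q : ℝ) * (omega 4 q * cZeroInf ((q : ℝ) ^ 2) / omegaInf ((q : ℝ) ^ 2)) := by
    positivity
  rw [cStar]
  nlinarith [mul_nonneg h6 h5]

theorem cStar_le {q : ℕ} (hq : 3 ≤ q) {c a b : ℝ} (hc : cZeroInf q ≤ c)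
    (ha : (q : ℝ) ^ 2 / ((q : ℝ) ^ 2 - 2) ≤ a)
    (hb : (q : ℝ) * Real.log (1 - ((q : ℝ) ^ 2)⁻¹) - Real.log (1 - (q : ℝ)⁻¹) ≤ b) :
    cStar q ≤ c + q * (omega 4 q * a) * b := by
  have hq' : (3 : ℝ) ≤ q := by exact_mod_cast hq
  have hQ : (9 : ℝ) ≤ (q : ℝ) ^ 2 := by nlinarith
  have h2 := cZeroInf_le (by linarith : (1 : ℝ) < (q : ℝ) ^ 2)
  have h2' := one_lt_cZeroInf (by linarith : (1 : ℝ) < (q : ℝ) ^ 2)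
  have h3 := omega_pos (by linarith : (1 : ℝ) < q) 4
  have h4 := le_omegaInf (by linarith : (1 : ℝ) < (q : ℝ) ^ 2)
  have h5 := log_combination_nonneg (by omega : 2 ≤ q)
  have hpos : (0 : ℝ) < (q : ℝ) ^ 2 - 2 := by linarith
  have hpos1 : (0 : ℝ) < (q : ℝ) ^ 2 - 1 := by linarith
  have h6 : 1 - ((q : ℝ) ^ 2 - 1)⁻¹ = ((q : ℝ) ^ 2 - 2) / ((q : ℝ) ^ 2 - 1) := by
    field_simp
    ring
  rw [h6] at h4
  -- With `Q = q²`, the estimates `Q/(Q - 1)` above and `(Q - 2)/(Q - 1)` below have quotient `Q/(Q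
  -- - 2)`.
  have h7 : cZeroInf ((q : ℝ) ^ 2) / omegaInf ((q : ℝ) ^ 2) ≤ a := by
    refine le_trans ?_ ha
    calc _ ≤ (q : ℝ) ^ 2 / ((q : ℝ) ^ 2 - 1) / (((q : ℝ) ^ 2 - 2) / ((q : ℝ) ^ 2 - 1)) := by
          gcongr
      _ = _ := by field_simp
  have ha0 : 0 ≤ a := le_trans (by positivity) ha
  rw [cStar, mul_div_assoc]
  gcongr

theorem cStar_lt_of_four_le {q : ℕ} (hq : 4 ≤ q) : cStar q < 1.56 := by
  have hq' : (4 : ℝ) ≤ q := by exact_mod_cast hq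
  have hQ : (16 : ℝ) ≤ (q : ℝ) ^ 2 := by nlinarith
  -- Here `8/7` is the value of `q²/(q² - 2)` at `q = 4`.
  have h := cStar_le (by omega) (cZeroInf_le (by linarith : (1 : ℝ) < q))
    (a := 8 / 7) (by rw [div_le_div_iff₀ (by linarith) (by norm_num)]; linarith)
    (log_combination_le (by linarith : (1 : ℝ) < q))
  refine h.trans_lt ?_
  have hω := omega_le_one_sub_inv (by linarith : (1 : ℝ) < q) (by norm_num : 4 ≠ 0)
  have hx : (q : ℝ)⁻¹ ≤ 1 / 4 := by
    rw [inv_eq_one_div]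
    exact one_div_le_one_div_of_le (by norm_num) hq'
  have hx0 : 0 < (q : ℝ)⁻¹ := by positivity
  have hq0 : (q : ℝ) = ((q : ℝ)⁻¹)⁻¹ := by rw [inv_inv]
  have hdiv : (q : ℝ) / (q - 1) ≤ 4 / 3 := by
    rw [div_le_div_iff₀ (by linarith) (by norm_num)]
    linarith
  have h1 : (q : ℝ) * (omega 4 q * (8 / 7)) * ((q : ℝ)⁻¹ ^ 2 / 2 + (q : ℝ)⁻¹ ^ 3 / (1 - (q : ℝ)⁻¹)) ≤
      (q : ℝ) * ((1 - (q : ℝ)⁻¹) * (8 / 7)) *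
        ((q : ℝ)⁻¹ ^ 2 / 2 + (q : ℝ)⁻¹ ^ 3 / (1 - (q : ℝ)⁻¹)) := by
    have : 0 < 1 - (q : ℝ)⁻¹ := by linarith
    gcongr
  have h2 : (q : ℝ) * ((1 - (q : ℝ)⁻¹) * (8 / 7)) *
        ((q : ℝ)⁻¹ ^ 2 / 2 + (q : ℝ)⁻¹ ^ 3 / (1 - (q : ℝ)⁻¹)) =
      8 / 7 * ((q : ℝ)⁻¹ * (1 - (q : ℝ)⁻¹) / 2 + (q : ℝ)⁻¹ ^ 2) := by
    have : (q : ℝ) - 1 ≠ 0 := by linarith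
    have : 1 - (q : ℝ)⁻¹ ≠ 0 := by linarith
    field_simp
  rw [h2] at h1
  generalize (q : ℝ)⁻¹ = x at *
  norm_num at *
  nlinarith

theorem cStar_three_lt : cStar (3 : ℕ) < 1.56 := by
  -- The general estimate `q/(q - 1) = 3/2` is too coarse here, so the factors with exponents `2` to
  -- `5` are computed exactly and only the tail is estimated.
  have hc : cZeroInf (3 : ℕ) ≤ 1.439 := by
    have h := le_tprod_one_sub_inv_pow (by norm_num : (1 : ℝ) < 3) 5
    rw [cZeroInf, Nat.cast_ofNat, tprod_one_sub_inv_pow_eq_mul (by norm_num) 2,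
      tprod_one_sub_inv_pow_eq_mul (by norm_num) 3, tprod_one_sub_inv_pow_eq_mul (by norm_num) 4,
      tprod_one_sub_inv_pow_eq_mul (by norm_num) 5]
    norm_num at h ⊢
    linarith
  have hb : ((3 : ℕ) : ℝ) * Real.log (1 - (((3 : ℕ) : ℝ) ^ 2)⁻¹) -
      Real.log (1 - ((3 : ℕ) : ℝ)⁻¹) ≤ 13 / 243 := by
    -- The combination equals `log (256/243)`, at most `256/243 - 1 = 13/243`.
    rw [← Real.log_pow, ← Real.log_div (by norm_num) (by norm_num)]
    refine (Real.log_le_sub_one_of_pos (by norm_num)).trans ?_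
    norm_num
  refine (cStar_le le_rfl hc (a := 9 / 7) (by norm_num) hb).trans_lt ?_
  have hω : omega 4 (3 : ℕ) = 2 / 3 * (8 / 9) * (26 / 27) * (80 / 81) := by
    rw [omega_succ, omega_succ, omega_succ, omega_succ, omega_zero]
    norm_num
  rw [hω]
  norm_num

theorem cStar_lt {q : ℕ} (hq : 3 ≤ q) : cStar q < 1.56 := by
  rcases hq.eq_or_lt with rfl | h
  · exact cStar_three_lt
  · exact cStar_lt_of_four_le h

end Constant
-- Admissibility of the rate `1 + q⁻¹ + 2q⁻²` for `q ≥ 4`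
section Rate

theorem recursionBound_eq (q : ℝ) :
    recursionBound q = q ^ 2 / ((q - 1) * (q ^ 2 - q - 1)) + 0.65 / (q * (q - 1)) := by
  rw [recursionBound, weightBound]
  ring

theorem recursionBound_le {q : ℝ} (hq : 4 ≤ q) :
    recursionBound q ≤ 2 * (1 + q⁻¹ + 2 * (q ^ 2)⁻¹ - 1) := by
  have h1 : 0 < q - 1 := by linarith
  have h2 : 0 < q ^ 2 - q - 1 := by nlinarith
  have hq0 : 0 < q := by linarith
  have h3 : 2 * (1 + q⁻¹ + 2 * (q ^ 2)⁻¹ - 1) = (2 * q + 4) / q ^ 2 := by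
    field_simp
    ring
  rw [recursionBound_eq, h3, div_add_div _ _ (by positivity) (by positivity),
    div_le_div_iff₀ (by positivity) (by positivity)]
  -- After clearing denominators and substituting `q = t + 4`, the difference is a polynomial in `t`
  -- with nonnegative coefficients.
  obtain ⟨t, rfl⟩ : ∃ t, q = t + 4 := ⟨q - 4, by ring⟩
  have ht : 0 ≤ t := by linarith
  rw [← sub_nonneg]
  ring_nf
  positivity

/-- This is the requirement on the leading constant with `c = 1`, which is stronger than needed for
`c*(q)`. -/
theorem mul_omega_mul_recursionBound_lt {q : ℝ} (hq : 4 ≤ q) :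
    q * omega 2 q * recursionBound q < (1 + q⁻¹ + 2 * (q ^ 2)⁻¹) ^ 2 := by
  have h1 : 0 < q - 1 := by linarith
  have h2 : 0 < q ^ 2 - q - 1 := by nlinarith
  have hq0 : 0 < q := by linarith
  have hω : omega 2 q = (q - 1) * (q ^ 2 - 1) / q ^ 3 := by
    rw [omega_succ, omega_succ, omega_zero]
    field_simp
    ring
  have hL : q * omega 2 q * recursionBound q =
      (q ^ 2 - 1) / (q ^ 2 - q - 1) + 0.65 * (q ^ 2 - 1) / q ^ 3 := by
    rw [hω, recursionBound_eq]
    field_simp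
  have hR : (1 + q⁻¹ + 2 * (q ^ 2)⁻¹) ^ 2 = (q ^ 2 + q + 2) ^ 2 / q ^ 4 := by
    field_simp
  rw [hL, hR, div_add_div _ _ (by positivity) (by positivity),
    div_lt_div_iff₀ (by positivity) (by positivity)]
  obtain ⟨t, rfl⟩ : ∃ t, q = t + 4 := ⟨q - 4, by ring⟩
  have ht : 0 ≤ t := by linarith
  rw [← sub_pos]
  ring_nf
  positivity

end Rate

end Uncyclic

theorem theoremT (q : ℕ) :
    (∀ (F : Type*) [Field F] [Finite F], Nat.card F = q → ∀ n : ℕ, 1 ≤ n →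
      (q = 3 →
        (Uncyclic.unc n F : ℝ) < 1.56 * 3 ^ ((n : ℤ) ^ 2 - n - 1) * 1.59 ^ n) ∧
      (4 ≤ q →
        (Uncyclic.unc n F : ℝ) <
          Uncyclic.cStar q * (q : ℝ) ^ ((n : ℤ) ^ 2 - n - 1) *
            (1 + (q : ℝ)⁻¹ + 2 * ((q : ℝ) ^ 2)⁻¹) ^ n)) ∧
    (3 ≤ q → 1 < Uncyclic.cStar q ∧ Uncyclic.cStar q < 1.56) := by
  refine ⟨fun F _ _ hF n hn => ⟨fun hq => ?_, fun hq => ?_⟩,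
    fun hq => ⟨Uncyclic.one_lt_cStar hq, Uncyclic.cStar_lt hq⟩⟩
  · rw [hq] at hF
    have hc : ((3 : ℕ) : ℝ) * Uncyclic.omega 2 (3 : ℕ) * Uncyclic.recursionBound (3 : ℕ) <
        1.56 * 1.59 ^ 2 := by
      rw [Uncyclic.omega_succ, Uncyclic.omega_succ, Uncyclic.omega_zero,
        Uncyclic.recursionBound_eq]
      norm_num
    have hl : Uncyclic.recursionBound (3 : ℕ) ≤ 2 * (1.59 - 1) := by
      rw [Uncyclic.recursionBound_eq]
      norm_num
    have h := Uncyclic.unc_lt_of_recursionBound (F := F) (r := 1.59) (c := 1.56) (by omega)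
      (by norm_num) (by rw [hF]; exact hl) (by rw [hF]; exact hc) hn
    rw [hF] at h
    exact_mod_cast h
  · subst hF
    have hq' : (4 : ℝ) ≤ Nat.card F := by exact_mod_cast hq
    have hr : (1 : ℝ) < 1 + (Nat.card F : ℝ)⁻¹ + 2 * ((Nat.card F : ℝ) ^ 2)⁻¹ := by
      have : (0 : ℝ) < Nat.card F := by linarith
      have : (0 : ℝ) < (Nat.card F : ℝ)⁻¹ + 2 * ((Nat.card F : ℝ) ^ 2)⁻¹ := by positivity
      linarith
    refine Uncyclic.unc_lt_of_recursionBound (by omega) hr (Uncyclic.recursionBound_le hq') ?_ hn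
    refine (Uncyclic.mul_omega_mul_recursionBound_lt hq').trans ?_
    -- Only `c*(q) > 1` is used of the constant.
    exact lt_mul_of_one_lt_left (by positivity) (Uncyclic.one_lt_cStar (by omega))
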